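/- **Setting.** Let $n\ge 1$, let $\Sigma\in\mathbb R^{n\times n}$ be symmetric positive definite with minimal eigenvalue $\lambda_{\min}$, and let $P_0,P_1\ge 0$, not both zero. Under hypothesis $\mathcal H_i$ ($i\in\{0,1\}$) the receiver observes $\mathbf Y=\mathbf S_i+\mathbf N$ with $\mathbf N\sim\mathcal N(0,\Sigma)$. The transmitter chooses $\mathcal S=(\mathbf S_0,\mathbf S_1)$ in $\mathbb S=\{\mathcal S:\|\mathbf S_0\|^2\le P_0,\ \|\mathbf S_1\|^2\le P_1\}$; the receiver chooses a decision rule, i.e. a measurable $\delta:\mathbb R^n\to\{0,1\}$. Write $\mathsf P_{ji}=\Pr(\delta(\mathbf Y)=j\mid\mathcal H_i)$. The transmitter ($k=t$) and the receiver ($k=r$) have priors $\pi_0^k,\pi_1^k\ge0$, $\pi_0^k+\pi_1^k=1$, with $\pi_i^t=0\iff\pi_i^r=0$, costs $C_{ji}^k\ge0$, and Bayes risks $r^k(\mathcal S,\delta)=\sum_{i}\pi_i^k\sum_jC_{ji}^k\mathsf P_{ji}$. A *reaction* is a map $\mathcal S\mapsto\delta^*_{\mathcal S}$ such that, for every $\mathcal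 S\in\mathbb S$, $\delta^*_{\mathcal S}$ minimizes $r^r(\mathcal S,\cdot)$ over all decision rules. Given a reaction, $(\mathcal S^*,\delta^*_{\mathcal S^*})$ with $\mathcal S^*\in\mathbb S$ is a *Stackelberg equilibrium* if $r^t(\mathcal S^*,\delta^*_{\mathcal S^*})\le r^t(\mathcal S,\delta^*_{\mathcal S})$ for all $\mathcal S\in\mathbb S$; it is *non-informative* if the decision has the same distribution under both hypotheses, and *informative* otherwise. Put $$\tau=\frac{\pi_0^r(C_{10}^r-C_{00}^r)}{\pi_1^r(C_{01}^r-C_{11}^r)},\quad \zeta=\operatorname{sgn}(C^r_{01}-C^r_{11}),\quad d=\sqrt{(\mathbf S_1-\mathbf S_0)^T\Sigma^{-1}(\mathbf S_1-\mathbf S_0)},\quad d_{\max}^2=\frac{(\sqrt{P_0}+\sqrt{P_1})^2}{\lambda_{\min}},$$ $$k_0=\pi_0^t\zeta(C_{10}^t-C_{00}^t)\tau^{-1/2},\qquad k_1=\pi_1^t\zeta(C_{01}^t-C_{11}^t)\tau^{1/2},\qquad \mathcal Q(x)=\tfrac1{\sqrt{2\pi}}\int_x^\infty e^{-u^2/2}\,du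 .$$ **Theorem.** (i) Suppose that the numerator and the denominator of $\tau$ are not both zero, and that $\tau\le0$ or the denominator is zero ($\tau=\infty$). Then reactions exist, and there is $j\in\{0,1\}$, the same for all reactions, such that for every reaction and every $\mathcal S\in\mathbb S$ the receiver decides $\mathcal H_j$ with probability one under both hypotheses, and $(\mathcal S,\delta^*_{\mathcal S})$ is a Stackelberg equilibrium. In particular all Stackelberg equilibria are non-informative. (ii) Suppose that $0<\tau<\infty$. Then there is a reaction that breaks ties evenly: whenever the receiver is indifferent between all decision rules, $\delta^*_{\mathcal S}$ chooses each hypothesis with probability $1/2$ under each hypothesis. Consider any reaction, which in the case $\tau=1$ and $k_0\neq k_1$ is assumed to break ties evenly. Let $D\subseteq[0,\infty)$ be the set of the values of $d$ in Stackelberg equilibria. Then $\mathcal S\in\mathbb S$ gives a Stackelberg equilibrium if and only if its distance $d$ lies in $D$, and, with $q=\left|\frac{2\ln\tau\,(k_0-k_1)}{k_0+k_1}\right|$ (where $k_0+k_1\ne0$): * if $\ln\tau\,(k_0-k_1)<0$ and $k_0+k_1<0$, then $D=\{\min\{d_{\max},\sqrt q\}\}$; * if $\ln\tau\,(k_0-k_1)<0$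 and $k_0+k_1\ge0$, then $D=\{d_{\max}\}$; * if $\ln\tau\,(k_0-k_1)\ge0$ and $k_0+k_1<0$, then $D=\{0\}$; * if $\ln\tau\,(k_0-k_1)\ge0$, $k_0+k_1>0$ and $d_{\max}^2<q$, then $D=\{0\}$; * if $\ln\tau\,(k_0-k_1)\ge0$, $k_0+k_1>0$ and $d_{\max}^2\ge q$, then $D=\{d_{\max}\}$, $D=\{0\}$ or $D=\{0,d_{\max}\}$ according as $$\left(\frac{k_1}{k_0\tau}\right)^{\operatorname{sgn}(\ln\tau)}\mathcal Q\!\left(\frac{|\ln\tau|}{d_{\max}}-\frac{d_{\max}}2\right)-\mathcal Q\!\left(\frac{|\ln\tau|}{d_{\max}}+\frac{d_{\max}}2\right)$$ is positive, negative or zero (for $\tau<1$ the first factor is read as $k_0\tau/k_1$, which is defined since then $k_1>0$); * if $k_0+k_1=0$ and $\ln\tau\,(k_0-k_1)>0$, then $D=\{0\}$; * if $k_0+k_1=0$ and $\ln\tau\,(k_0-k_1)=0$, then $D=[0,d_{\max}]$. An equilibrium with $d=0$ has $\mathbf S_0=\mathbf S_1$ and is non-informative, and if moreover $\tau\ne1$,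 the receiver always decides for one and the same hypothesis with probability one. An equilibrium with $d\neq0$ is informative. Finally, let $\boldsymbol\nu$ be any eigenvector of $\Sigma$ for $\lambda_{\min}$. Every $x\in D$ is realized by signals along $\boldsymbol\nu$: there are $s_0,s_1\in\mathbb R$ with $|s_i|\le\sqrt{P_i}$ and $|s_1-s_0|=\sqrt{\lambda_{\min}}\,x$, and for all such $s_0,s_1$ the signals $\mathbf S_i=s_i\boldsymbol\nu/\|\boldsymbol\nu\|$ give a Stackelberg equilibrium with $d=x$. In particular, if $d_{\max}\in D$, then $\mathbf S_0=\pm\sqrt{P_0}\,\boldsymbol\nu/\|\boldsymbol\nu\|$, $\mathbf S_1=\mp\sqrt{P_1}\,\boldsymbol\nu/\|\boldsymbol\nu\|$ give Stackelberg equilibria. -/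

import Mathlib

open MeasureTheory ProbabilityTheory Matrix

noncomputable section

namespace BinarySignaling

/-- The subjective model of one player: `prior i` is the prior probability of hypothesis `i`, and
`cost j i` is the cost of deciding for hypothesis `j` when hypothesis `i` is true. -/
structure Player where
  prior : Fin 2 → ℝ
  cost : Fin 2 → Fin 2 → ℝ
  prior_nonneg : ∀ i, 0 ≤ prior i
  prior_sum : prior 0 + prior 1 = 1
  cost_nonneg : ∀ j i, 0 ≤ cost j i

/-- A pair of signals: `S i` is the signal sent under hypothesis `i`. -/
abbrev Signals (n : ℕ) := Fin 2 → EuclideanSpace ℝ (Fin n)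

/-- The signal pairs that satisfy the power constraints `‖S i‖² ≤ P i`. -/
def feasible (n : ℕ) (P : Fin 2 → ℝ) : Set (Signals n) :=
  {S | ∀ i, ‖S i‖ ^ 2 ≤ P i}

/-- A decision rule: a measurable map from observations to hypotheses, that is, a measurable
partition of `ℝⁿ` into the two decision regions. -/
def DecisionRule (n : ℕ) := {δ : EuclideanSpace ℝ (Fin n) → Fin 2 // Measurable δ}

/-- The probability of deciding for hypothesis `j` when hypothesis `i` is true; the observation is
then distributed according to `N(S i, Sigma)`. -/
def condProb {n : ℕ} (Sigma : Matrix (Fin n) (Fin n) ℝ) (S : Signals n) (δ : DecisionRule n)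
    (j i : Fin 2) : ℝ :=
  (multivariateGaussian (S i) Sigma).real {y | δ.1 y = j}

/-- The Bayes risk of a player. -/
def bayesRisk {n : ℕ} (p : Player) (Sigma : Matrix (Fin n) (Fin n) ℝ) (S : Signals n)
    (δ : DecisionRule n) : ℝ :=
  ∑ i, p.prior i * ∑ j, p.cost j i * condProb Sigma S δ j i

/-- `δ` minimizes the Bayes risk of the receiver `r` when the signals are `S`. -/
def IsBestResponse {n : ℕ} (r : Player) (Sigma : Matrix (Fin n) (Fin n) ℝ) (S : Signals n)
    (δ : DecisionRule n) : Prop :=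
  ∀ η : DecisionRule n, bayesRisk r Sigma S δ ≤ bayesRisk r Sigma S η

/-- `ρ` assigns to each feasible signal pair an optimal decision rule of the receiver. -/
def IsReaction {n : ℕ} (r : Player) (Sigma : Matrix (Fin n) (Fin n) ℝ) (P : Fin 2 → ℝ)
    (ρ : Signals n → DecisionRule n) : Prop :=
  ∀ S ∈ feasible n P, IsBestResponse r Sigma S (ρ S)

/-- Total ties are broken evenly: when the receiver is indifferent between all decision rules,
each hypothesis is chosen with probability one half. -/
def BreaksTiesEvenly {n : ℕ} (r : Player) (Sigma : Matrix (Fin n) (Fin n) ℝ) (P : Fin 2 → ℝ)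
    (ρ : Signals n → DecisionRule n) : Prop :=
  ∀ S ∈ feasible n P, (∀ η : DecisionRule n, IsBestResponse r Sigma S η) →
    ∀ j i, condProb Sigma S (ρ S) j i = 1 / 2

/-- `(S, ρ S)` is a Stackelberg equilibrium, the transmitter `t` being the leader and the
receiver `r` being the follower, who reacts by `ρ`. -/
def IsStackelberg {n : ℕ} (t r : Player) (Sigma : Matrix (Fin n) (Fin n) ℝ) (P : Fin 2 → ℝ)
    (ρ : Signals n → DecisionRule n) (S : Signals n) : Prop :=
  S ∈ feasible n P ∧ IsReaction r Sigma P ρ ∧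
    ∀ S' ∈ feasible n P, bayesRisk t Sigma S (ρ S) ≤ bayesRisk t Sigma S' (ρ S')

/-- The decision carries no information about the hypothesis: it has the same distribution under
both hypotheses. -/
def NonInformative {n : ℕ} (Sigma : Matrix (Fin n) (Fin n) ℝ) (S : Signals n)
    (δ : DecisionRule n) : Prop :=
  ∀ j, condProb Sigma S δ j 0 = condProb Sigma S δ j 1

/-- `d = √((S₁ - S₀)ᵀ Σ⁻¹ (S₁ - S₀))`. -/
def signalDist {n : ℕ} (Sigma : Matrix (Fin n) (Fin n) ℝ) (S : Signals n) : ℝ :=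
  Real.sqrt ((S 1 - S 0).ofLp ⬝ᵥ (Sigma⁻¹ *ᵥ (S 1 - S 0).ofLp))

/-- `d_max`, where `lam` is the minimal eigenvalue of the noise covariance. -/
def dMax (P : Fin 2 → ℝ) (lam : ℝ) : ℝ :=
  Real.sqrt ((Real.sqrt (P 0) + Real.sqrt (P 1)) ^ 2 / lam)

/-- The distances `d` that occur in Stackelberg equilibria with receiver reaction `ρ`. -/
def equilibriumDistances {n : ℕ} (t r : Player) (Sigma : Matrix (Fin n) (Fin n) ℝ)
    (P : Fin 2 → ℝ) (ρ : Signals n → DecisionRule n) : Set ℝ :=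
  {x | ∃ S, IsStackelberg t r Sigma P ρ S ∧ signalDist Sigma S = x}

/-- The signals `(s₀ ν / ‖ν‖, s₁ ν / ‖ν‖)`. -/
def signalsAlong {n : ℕ} (ν : EuclideanSpace ℝ (Fin n)) (s₀ s₁ : ℝ) : Signals n :=
  ![(s₀ / ‖ν‖) • ν, (s₁ / ‖ν‖) • ν]

/-- The numerator of `τ`. -/
def tauNum (r : Player) : ℝ := r.prior 0 * (r.cost 1 0 - r.cost 0 0)

/-- The denominator of `τ`. -/
def tauDen (r : Player) : ℝ := r.prior 1 * (r.cost 0 1 - r.cost 1 1)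

/-- The threshold of the likelihood ratio test; meaningful if `tauDen r ≠ 0`. -/
def tau (r : Player) : ℝ := tauNum r / tauDen r

def zeta (r : Player) : ℝ := Real.sign (r.cost 0 1 - r.cost 1 1)

def k₀ (t r : Player) : ℝ :=
  t.prior 0 * zeta r * (t.cost 1 0 - t.cost 0 0) * tau r ^ (-1 / 2 : ℝ)

def k₁ (t r : Player) : ℝ :=
  t.prior 1 * zeta r * (t.cost 0 1 - t.cost 1 1) * tau r ^ (1 / 2 : ℝ)

/-- The standard Gaussian tail function. -/
def Q (x : ℝ) : ℝ :=
  1 / Real.sqrt (2 * Real.pi) * ∫ u in Set.Ioi x, Real.exp (-u ^ 2 / 2)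

/-- The quantity whose sign decides between `d* = d_max` and `d* = 0`. -/
def decisionGap (t r : Player) (d : ℝ) : ℝ :=
  (k₁ t r / (k₀ t r * tau r)) ^ (SignType.sign (Real.log (tau r)) : ℤ)
      * Q (|Real.log (tau r)| / d - d / 2)
    - Q (|Real.log (tau r)| / d + d / 2)

end BinarySignaling

end

/-!
The receiver's risk is, up to a constant, a positive multiple of `τ P_{j0} - P_{j1}` for a fixed
hypothesis `j` (`exists_isFavoured`), where `P_{ji}` is the probability of deciding for `j` under
hypothesis `i`. The law `N(S₁, Σ)` has the density `exp ℓ` with respect to `N(S₀, Σ)`, where `ℓ` is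
affine (`logLikelihood`, a consequence of the Cameron–Martin formula
`multivariateGaussian_tilted_inner`), so an optimal receiver decides for `j` exactly when
`ln τ < ℓ`, up to null sets (`ae_eq_pos_of_setIntegral_le`, the uniqueness part of the
Neyman–Pearson lemma). The exception is total indifference, which happens only for `S₀ = S₁` and
`τ = 1`. Under either hypothesis `ℓ` is Gaussian with variance `d²`, hence the two probabilities
are `Q (ln τ / d ± d / 2)` (`exceedProb`), and the transmitter's risk is a function of the distance
`d` alone (`exists_bayesRisk_eq_leaderRisk`). This function is continuous down to `d = 0`: for
`τ ≠ 1` the limit is the risk of a constant decision, for `τ = 1` it is the risk of an even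
tie-break, which is the risk of any tie-break if `k₀ = k₁`.

By the Rayleigh quotient, `d ≤ d_max` for all admissible signals, and signals along an eigenvector
of the minimal eigenvalue realize every distance in `[0, d_max]`. The equilibria are therefore the
signals whose distance minimizes the risk over `[0, d_max]` (`isStackelberg_iff`). The derivative of
the risk has the sign of `2 ln τ (k₀ - k₁) - (k₀ + k₁) d²` (`hasDerivAt_distanceRisk`), which
changes sign at most once, at `d² = q`; the table lists the resulting shapes. Only when the risk
first increases and then decreases do the two end points have to be compared, and the difference of
their risks is a negative multiple of `decisionGap` (`leaderRisk_sub_zero`).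

If `τ ≤ 0` or `τ = ∞`, the receiver's risk decreases in the probabilities of one decision under both
hypotheses, and strictly in at least one of them. Since the two Gaussian laws are mutually
absolutely continuous, that decision is taken almost surely, and the transmitter's risk is constant.
-/

noncomputable section

namespace BinarySignaling

open scoped RealInnerProductSpace

/-! ### Gaussian measures: linear functionals and exponential tilting -/

section Gaussian

variable {n : ℕ} {Sigma : Matrix (Fin n) (Fin n) ℝ}

theorem multivariateGaussian_map_inner (hS : Sigma.PosSemidef) (m a : EuclideanSpace ℝ (Fin n)) :
    (multivariateGaussian m Sigma).map (fun y ↦ ⟪a, y⟫) =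
      gaussianReal ⟪a, m⟫ (a.ofLp ⬝ᵥ Sigma *ᵥ a.ofLp).toNNReal := by
  have h := IsGaussian.map_eq_gaussianReal (μ := multivariateGaussian m Sigma) (innerSL ℝ a)
  have hm : (multivariateGaussian m Sigma)[innerSL ℝ a] = ⟪a, m⟫ := by
    rw [ContinuousLinearMap.integral_comp_id_comm IsGaussian.integrable_id,
      integral_id_multivariateGaussian, innerSL_apply_apply]
  have hv : Var[innerSL ℝ a; multivariateGaussian m Sigma] = a.ofLp ⬝ᵥ Sigma *ᵥ a.ofLp := by
    rw [← covarianceBilin_multivariateGaussian (μ := m) hS,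
      covarianceBilin_self IsGaussian.memLp_two_id]
    rfl
  rw [hm, hv] at h
  exact h

theorem integrable_exp_inner_multivariateGaussian (hS : Sigma.PosSemidef)
    (m a : EuclideanSpace ℝ (Fin n)) (s : ℝ) :
    Integrable (fun y ↦ Real.exp (s * ⟪a, y⟫)) (multivariateGaussian m Sigma) := by
  have h : Integrable (fun x : ℝ ↦ Real.exp (s * x))
      ((multivariateGaussian m Sigma).map (fun y ↦ ⟪a, y⟫)) := by
    rw [multivariateGaussian_map_inner hS]
    exact integrable_exp_mul_gaussianReal s
  exact h.comp_measurable (by fun_prop)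

theorem integral_exp_inner_multivariateGaussian (hS : Sigma.PosSemidef)
    (m a : EuclideanSpace ℝ (Fin n)) :
    ∫ y, Real.exp ⟪a, y⟫ ∂(multivariateGaussian m Sigma) =
      Real.exp (⟪a, m⟫ + (a.ofLp ⬝ᵥ Sigma *ᵥ a.ofLp) / 2) := by
  have h := mgf_gaussianReal (multivariateGaussian_map_inner hS m a) 1
  have hnn : 0 ≤ a.ofLp ⬝ᵥ Sigma *ᵥ a.ofLp := by
    simpa using hS.dotProduct_mulVec_nonneg a.ofLp
  simpa [mgf, Real.coe_toNNReal _ hnn] using h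

/-- A Cameron–Martin formula: tilting a Gaussian measure by the functional `⟪a, ·⟫` translates its
mean by `Sigma a`. Both sides have the same moment generating functions along every direction. -/
theorem multivariateGaussian_tilted_inner (hS : Sigma.PosSemidef)
    (m a : EuclideanSpace ℝ (Fin n)) :
    (multivariateGaussian m Sigma).tilted (fun y ↦ ⟪a, y⟫) =
      multivariateGaussian (m + toEuclideanCLM (𝕜 := ℝ) Sigma a) Sigma := by
  have hint : Integrable (fun y ↦ Real.exp ⟪a, y⟫) (multivariateGaussian m Sigma) := by
    simpa using integrable_exp_inner_multivariateGaussian hS m a 1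
  have : IsProbabilityMeasure ((multivariateGaussian m Sigma).tilted (fun y ↦ ⟪a, y⟫)) :=
    isProbabilityMeasure_tilted hint
  apply Measure.ext_of_charFun
  ext t
  set m' := m + toEuclideanCLM (𝕜 := ℝ) Sigma a with hm'
  have hmgf : mgf (fun y ↦ ⟪t, y⟫) (multivariateGaussian m' Sigma) =
      mgf (fun y ↦ ⟪t, y⟫) ((multivariateGaussian m Sigma).tilted (fun y ↦ ⟪a, y⟫)) := by
    ext s
    simp only [mgf]
    rw [integral_exp_tilted]
    have h1 : ∀ y : EuclideanSpace ℝ (Fin n), s * ⟪t, y⟫ = ⟪s • t, y⟫ := fun y ↦ by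
      rw [real_inner_smul_left]
    have h2 : ∀ y : EuclideanSpace ℝ (Fin n),
        ((fun y ↦ ⟪a, y⟫) + fun y ↦ s * ⟪t, y⟫ : EuclideanSpace ℝ (Fin n) → ℝ) y
          = ⟪a + s • t, y⟫ := fun y ↦ by
      simp [inner_add_left, real_inner_smul_left]
    simp_rw [h2, h1]
    rw [integral_exp_inner_multivariateGaussian hS, integral_exp_inner_multivariateGaussian hS,
      integral_exp_inner_multivariateGaussian hS, ← Real.exp_sub]
    congr 1
    have hsymm : ⟪a, toEuclideanCLM (𝕜 := ℝ) Sigma t⟫ = ⟪t, toEuclideanCLM (𝕜 := ℝ) Sigma a⟫ := by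
      simpa [covarianceBilin_multivariateGaussian hS, inner_toEuclideanCLM] using
        covarianceBilin_comm (μ := multivariateGaussian m Sigma) a t
    simp only [← inner_toEuclideanCLM, map_add, map_smul, inner_add_left, inner_add_right,
      real_inner_smul_left, real_inner_smul_right, hm', hsymm]
    ring
  have hI := eqOn_complexMGF_of_mgf hmgf (x := Complex.I) (by
    have : integrableExpSet (fun y ↦ ⟪t, y⟫) (multivariateGaussian m' Sigma) = Set.univ :=
      Set.eq_univ_of_forall fun s ↦ integrable_exp_inner_multivariateGaussian hS m' t s
    simp [this])
  simp only [complexMGF] at hI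
  rw [charFun_apply, charFun_apply]
  simp_rw [real_inner_comm t, mul_comm _ Complex.I]
  exact hI.symm

end Gaussian

/-! ### The Gaussian tail function -/

section Tail

open Filter Topology

theorem Q_eq_gaussianReal (x : ℝ) : Q x = (gaussianReal 0 1).real (Set.Ioi x) := by
  rw [measureReal_def, gaussianReal_apply_eq_integral _ one_ne_zero, ENNReal.toReal_ofReal
    (integral_nonneg fun _ ↦ gaussianPDFReal_nonneg _ _ _), Q, ← integral_const_mul]
  simp [gaussianPDFReal]

theorem Q_eq_one_sub_cdf (x : ℝ) : Q x = 1 - cdf (gaussianReal 0 1) x := by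
  rw [Q_eq_gaussianReal, cdf_eq_real, ← Set.compl_Iic, probReal_compl_eq_one_sub measurableSet_Iic]

theorem tendsto_Q_atTop : Tendsto Q atTop (𝓝 0) := by
  have := (tendsto_cdf_atTop (gaussianReal 0 1)).const_sub 1
  simpa [funext Q_eq_one_sub_cdf] using this

theorem tendsto_Q_atBot : Tendsto Q atBot (𝓝 1) := by
  have := (tendsto_cdf_atBot (gaussianReal 0 1)).const_sub 1
  simpa [funext Q_eq_one_sub_cdf] using this

theorem gaussianReal_real_Ioi (m c : ℝ) {d : ℝ} (hd : 0 < d) :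
    (gaussianReal m (d ^ 2).toNNReal).real (Set.Ioi c) = Q ((c - m) / d) := by
  have h : gaussianReal m (d ^ 2).toNNReal = (gaussianReal 0 1).map (fun x ↦ m + d * x) := by
    have h1 : (gaussianReal 0 1).map (fun x ↦ m + d * x) =
        ((gaussianReal 0 1).map (d * ·)).map (m + ·) := by
      rw [Measure.map_map (by fun_prop) (by fun_prop)]
      rfl
    rw [h1, gaussianReal_map_const_mul, gaussianReal_map_const_add]
    congr 1
    · simp
    · ext
      simp [sq_nonneg]
  rw [h, map_measureReal_apply (by fun_prop) measurableSet_Ioi, Q_eq_gaussianReal]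
  congr 1
  ext x
  simp only [Set.mem_preimage, Set.mem_Ioi, div_lt_iff₀ hd]
  constructor <;> intro h <;> linarith

theorem Q_neg (x : ℝ) : Q (-x) = 1 - Q x := by
  have h := gaussianReal_map_neg (μ := 0) (v := 1)
  have : NullSingletonClass (gaussianReal 0 1) := nullSingletonClass_gaussianReal one_ne_zero
  rw [Q_eq_one_sub_cdf, Q_eq_gaussianReal, cdf_eq_real]
  congr 1
  nth_rewrite 1 [← neg_zero, ← h]
  rw [map_measureReal_apply (by fun_prop) measurableSet_Iic]
  have : (fun x : ℝ ↦ -x) ⁻¹' Set.Iic (-x) = Set.Ici x := by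
    ext; simp
  rw [this]
  exact (measureReal_congr Ioi_ae_eq_Ici).symm

theorem Q_zero : Q 0 = 1 / 2 := by
  have := Q_neg 0
  rw [neg_zero] at this
  linarith

theorem hasDerivAt_Q (x : ℝ) :
    HasDerivAt Q (-(1 / Real.sqrt (2 * Real.pi) * Real.exp (-x ^ 2 / 2))) x := by
  have hint : Integrable (fun u : ℝ ↦ Real.exp (-u ^ 2 / 2)) := by
    have := integrable_exp_neg_mul_sq (b := 1 / 2) (by norm_num)
    refine this.congr (Eventually.of_forall fun u ↦ ?_)
    simp only
    congr 1
    ring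
  have hcont : Continuous (fun u : ℝ ↦ Real.exp (-u ^ 2 / 2)) := by fun_prop
  have hQ : Q = fun x ↦ Q 0 - 1 / Real.sqrt (2 * Real.pi) * ∫ u in (0 : ℝ)..x,
      Real.exp (-u ^ 2 / 2) := by
    ext y
    rw [Q, Q, ← mul_sub, ← intervalIntegral.integral_Ioi_sub_Ioi' hint.integrableOn
      hint.integrableOn]
    ring
  rw [hQ]
  have := (intervalIntegral.integral_hasDerivAt_right (hcont.intervalIntegrable 0 x)
    (hcont.stronglyMeasurableAtFilter _ _) hcont.continuousAt)
  simpa using (this.const_mul (1 / Real.sqrt (2 * Real.pi))).const_sub (Q 0)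

theorem continuous_Q : Continuous Q :=
  continuous_iff_continuousAt.2 fun x ↦ (hasDerivAt_Q x).continuousAt

theorem strictAnti_Q : StrictAnti Q := by
  refine strictAnti_of_deriv_neg fun x ↦ ?_
  rw [(hasDerivAt_Q x).deriv]
  have : 0 < 1 / Real.sqrt (2 * Real.pi) := by positivity
  have := mul_pos this (Real.exp_pos (-x ^ 2 / 2))
  linarith

end Tail

/-! ### The log-likelihood ratio -/

section LogLikelihood

variable {n : ℕ} {Sigma : Matrix (Fin n) (Fin n) ℝ}

/-- The vector `Σ⁻¹ (S₁ - S₀)`, along which the optimal receiver correlates the observation. -/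
def matchedFilter (Sigma : Matrix (Fin n) (Fin n) ℝ) (S : Signals n) :
    EuclideanSpace ℝ (Fin n) :=
  WithLp.toLp 2 (Sigma⁻¹ *ᵥ (S 1 - S 0).ofLp)

/-- The logarithm of the density of `N(S₁, Σ)` with respect to `N(S₀, Σ)`. -/
def logLikelihood (Sigma : Matrix (Fin n) (Fin n) ℝ) (S : Signals n)
    (y : EuclideanSpace ℝ (Fin n)) : ℝ :=
  ⟪matchedFilter Sigma S, y - S 0⟫ - signalDist Sigma S ^ 2 / 2

theorem toEuclideanCLM_matchedFilter (hSigma : Sigma.PosDef) (S : Signals n) :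
    toEuclideanCLM (𝕜 := ℝ) Sigma (matchedFilter Sigma S) = S 1 - S 0 := by
  have := hSigma.isUnit
  rw [Matrix.isUnit_iff_isUnit_det] at this
  simp [matchedFilter, toEuclideanCLM_toLp, Matrix.mulVec_mulVec, Matrix.mul_nonsing_inv _ this]

theorem signalDist_nonneg (S : Signals n) : 0 ≤ signalDist Sigma S := Real.sqrt_nonneg _

theorem sq_signalDist (hSigma : Sigma.PosDef) (S : Signals n) :
    signalDist Sigma S ^ 2 = (S 1 - S 0).ofLp ⬝ᵥ (Sigma⁻¹ *ᵥ (S 1 - S 0).ofLp) := by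
  rw [signalDist, Real.sq_sqrt]
  simpa using hSigma.inv.posSemidef.dotProduct_mulVec_nonneg (S 1 - S 0).ofLp

theorem inner_matchedFilter_sub (hSigma : Sigma.PosDef) (S : Signals n) :
    ⟪matchedFilter Sigma S, S 1 - S 0⟫ = signalDist Sigma S ^ 2 := by
  rw [sq_signalDist hSigma, EuclideanSpace.inner_eq_star_dotProduct]
  simp [matchedFilter]

theorem matchedFilter_variance (hSigma : Sigma.PosDef) (S : Signals n) :
    (matchedFilter Sigma S).ofLp ⬝ᵥ Sigma *ᵥ (matchedFilter Sigma S).ofLp =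
      signalDist Sigma S ^ 2 := by
  rw [← inner_toEuclideanCLM, toEuclideanCLM_matchedFilter hSigma, inner_matchedFilter_sub hSigma]

theorem signalDist_eq_zero_iff (hSigma : Sigma.PosDef) (S : Signals n) :
    signalDist Sigma S = 0 ↔ S 0 = S 1 := by
  constructor
  · intro h
    have h2 := sq_signalDist hSigma S
    rw [h] at h2
    by_contra hne
    have hx : (S 1 - S 0).ofLp ≠ 0 := fun h0 ↦ hne <| by
      have : S 1 - S 0 = 0 := by
        ext i
        exact congrFun h0 i
      exact (sub_eq_zero.1 this).symm
    have := hSigma.inv.dotProduct_mulVec_pos hx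
    simp only [star_trivial] at this
    linarith
  · intro h
    simp [signalDist, h]

theorem measurable_logLikelihood (S : Signals n) : Measurable (logLikelihood Sigma S) := by
  unfold logLikelihood
  fun_prop

theorem logLikelihood_of_eq {S : Signals n} (h : S 0 = S 1) (y : EuclideanSpace ℝ (Fin n)) :
    logLikelihood Sigma S y = 0 := by
  simp [logLikelihood, matchedFilter, signalDist, h]

theorem multivariateGaussian_eq_tilted (hSigma : Sigma.PosDef) (S : Signals n) :
    multivariateGaussian (S 1) Sigma =
      (multivariateGaussian (S 0) Sigma).tilted (fun y ↦ ⟪matchedFilter Sigma S, y⟫) := by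
  rw [multivariateGaussian_tilted_inner hSigma.posSemidef, toEuclideanCLM_matchedFilter hSigma,
    add_sub_cancel]

theorem multivariateGaussian_absolutelyContinuous (hSigma : Sigma.PosDef) (S : Signals n) :
    multivariateGaussian (S 1) Sigma ≪ multivariateGaussian (S 0) Sigma := by
  rw [multivariateGaussian_eq_tilted hSigma]
  exact tilted_absolutelyContinuous _ _

theorem exp_logLikelihood (hSigma : Sigma.PosDef) (S : Signals n)
    (y : EuclideanSpace ℝ (Fin n)) :
    Real.exp (logLikelihood Sigma S y) = Real.exp ⟪matchedFilter Sigma S, y⟫ /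
      ∫ x, Real.exp ⟪matchedFilter Sigma S, x⟫ ∂(multivariateGaussian (S 0) Sigma) := by
  rw [integral_exp_inner_multivariateGaussian hSigma.posSemidef, matchedFilter_variance hSigma,
    ← Real.exp_sub, logLikelihood, inner_sub_right]
  congr 1
  ring

theorem integrable_exp_logLikelihood (hSigma : Sigma.PosDef) (S : Signals n) :
    Integrable (fun y ↦ Real.exp (logLikelihood Sigma S y))
      (multivariateGaussian (S 0) Sigma) := by
  simp_rw [exp_logLikelihood hSigma]
  have := integrable_exp_inner_multivariateGaussian hSigma.posSemidef (S 0)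
    (matchedFilter Sigma S) 1
  simp only [one_mul] at this
  exact this.div_const _

theorem multivariateGaussian_real_eq_setIntegral (hSigma : Sigma.PosDef) (S : Signals n)
    {E : Set (EuclideanSpace ℝ (Fin n))} (hE : MeasurableSet E) :
    (multivariateGaussian (S 1) Sigma).real E =
      ∫ y in E, Real.exp (logLikelihood Sigma S y) ∂(multivariateGaussian (S 0) Sigma) := by
  rw [multivariateGaussian_eq_tilted hSigma, measureReal_def, tilted_apply_eq_ofReal_integral' _ hE,
    ENNReal.toReal_ofReal]
  · simp_rw [exp_logLikelihood hSigma]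
  · refine integral_nonneg fun y ↦ div_nonneg (Real.exp_pos _).le (integral_nonneg fun y ↦ ?_)
    exact (Real.exp_pos _).le

/-- The probability under hypothesis `i` that the log-likelihood ratio exceeds `L`, for signals at
distance `d`. The value at `d = 0` is the limit as `d → 0`; for `L ≠ 0` it is also the actual
probability, for `L = 0` it corresponds to breaking ties evenly. -/
def exceedProb (i : Fin 2) (L d : ℝ) : ℝ :=
  if d = 0 then (if 0 < L then 0 else if L < 0 then 1 else 1 / 2)
  else Q (L / d + (-1) ^ (i : ℕ) * (d / 2))

theorem multivariateGaussian_real_lt_logLikelihood (hSigma : Sigma.PosDef) (S : Signals n) {L : ℝ}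
    (h : signalDist Sigma S ≠ 0 ∨ L ≠ 0) (i : Fin 2) :
    (multivariateGaussian (S i) Sigma).real {y | L < logLikelihood Sigma S y} =
      exceedProb i L (signalDist Sigma S) := by
  by_cases hd : signalDist Sigma S = 0
  · have hL : L ≠ 0 := h.resolve_left (not_not.2 hd)
    simp_rw [logLikelihood_of_eq ((signalDist_eq_zero_iff hSigma S).1 hd)]
    rcases lt_or_gt_of_ne hL with hL | hL
    · simp [exceedProb, hd, hL, hL.not_gt]
    · simp [exceedProb, hd, hL, hL.not_gt]
  · have hd' : 0 < signalDist Sigma S := (signalDist_nonneg S).lt_of_ne' hd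
    set w := matchedFilter Sigma S with hw
    have hset : {y | L < logLikelihood Sigma S y} = (fun y ↦ ⟪w, y⟫) ⁻¹'
        Set.Ioi (L + signalDist Sigma S ^ 2 / 2 + ⟪w, S 0⟫) := by
      ext y
      simp only [logLikelihood, inner_sub_right, Set.mem_ofPred_eq, Set.mem_preimage, Set.mem_Ioi,
        ← hw]
      constructor <;> intro h <;> linarith
    have hw2 := inner_matchedFilter_sub hSigma S
    rw [inner_sub_right, ← hw] at hw2
    rw [hset, ← map_measureReal_apply (by fun_prop) measurableSet_Ioi,
      multivariateGaussian_map_inner hSigma.posSemidef, matchedFilter_variance hSigma,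
      gaussianReal_real_Ioi _ _ hd', exceedProb, if_neg hd]
    congr 1
    fin_cases i
    · simp
      field_simp
    · simp
      field_simp
      linarith

theorem measure_logLikelihood_eq (hSigma : Sigma.PosDef) (S : Signals n) {L : ℝ}
    (h : signalDist Sigma S ≠ 0 ∨ L ≠ 0) :
    multivariateGaussian (S 0) Sigma {y | logLikelihood Sigma S y = L} = 0 := by
  by_cases hd : signalDist Sigma S = 0
  · have hL : L ≠ 0 := h.resolve_left (not_not.2 hd)
    simp [logLikelihood_of_eq ((signalDist_eq_zero_iff hSigma S).1 hd), hL.symm]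
  · have hv : (signalDist Sigma S ^ 2).toNNReal ≠ 0 := by
      have : 0 < signalDist Sigma S := (signalDist_nonneg S).lt_of_ne' hd
      simp only [ne_eq, Real.toNNReal_eq_zero, not_le]
      positivity
    set w := matchedFilter Sigma S with hw
    have hset : {y | logLikelihood Sigma S y = L} = (fun y ↦ ⟪w, y⟫) ⁻¹'
        {L + signalDist Sigma S ^ 2 / 2 + ⟪w, S 0⟫} := by
      ext y
      simp only [logLikelihood, inner_sub_right, Set.mem_ofPred_eq, Set.mem_preimage,
        Set.mem_singleton_iff, ← hw]
      constructor <;> intro h <;> linarith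
    have : NullSingletonClass (gaussianReal ⟪w, S 0⟫ (signalDist Sigma S ^ 2).toNNReal) :=
      nullSingletonClass_gaussianReal hv
    rw [hset, ← Measure.map_apply (by fun_prop) (measurableSet_singleton _),
      multivariateGaussian_map_inner hSigma.posSemidef, matchedFilter_variance hSigma]
    exact measure_singleton _

theorem exists_measurableSet_multivariateGaussian_eq_half [NeZero n] (hSigma : Sigma.PosDef)
    (m : EuclideanSpace ℝ (Fin n)) :
    ∃ E, MeasurableSet E ∧ (multivariateGaussian m Sigma).real E = 1 / 2 := by
  let a : EuclideanSpace ℝ (Fin n) := EuclideanSpace.single 0 1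
  have ha : a.ofLp ≠ 0 := fun h ↦ by simpa [a] using congrFun h 0
  have hv : 0 < a.ofLp ⬝ᵥ Sigma *ᵥ a.ofLp := by simpa using hSigma.dotProduct_mulVec_pos ha
  refine ⟨(fun y ↦ ⟪a, y⟫) ⁻¹' Set.Ioi ⟪a, m⟫, ?_, ?_⟩
  · exact measurableSet_Ioi.preimage (by fun_prop)
  · have := gaussianReal_real_Ioi ⟪a, m⟫ ⟪a, m⟫ (Real.sqrt_pos.2 hv)
    rw [Real.sq_sqrt hv.le, ← multivariateGaussian_map_inner hSigma.posSemidef,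
      map_measureReal_apply (by fun_prop) measurableSet_Ioi] at this
    rw [this, sub_self, zero_div, Q_zero]

end LogLikelihood

/-! ### The optimal receiver -/

section NeymanPearson

theorem indicator_le_indicator_pos {α : Type*} (f : α → ℝ) (E : Set α) (x : α) :
    0 ≤ {x | 0 < f x}.indicator f x - E.indicator f x := by
  by_cases h : 0 < f x <;> by_cases hx : x ∈ E <;> simp [Set.indicator, h, hx]
  · exact h.le
  · exact not_lt.1 h

variable {α : Type*} [MeasurableSpace α] {μ : Measure α} {f : α → ℝ}

theorem setIntegral_pos_sub_setIntegral (hf : Integrable f μ) (hfm : Measurable f) {E : Set α}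
    (hE : MeasurableSet E) :
    ∫ x in {x | 0 < f x}, f x ∂μ - ∫ x in E, f x ∂μ =
      ∫ x, ({x | 0 < f x}.indicator f x - E.indicator f x) ∂μ := by
  have hP : MeasurableSet {x | 0 < f x} := measurableSet_lt measurable_const hfm
  rw [integral_sub (hf.indicator hP) (hf.indicator hE), integral_indicator hP,
    integral_indicator hE]

theorem setIntegral_le_setIntegral_pos (hf : Integrable f μ) (hfm : Measurable f) {E : Set α}
    (hE : MeasurableSet E) : ∫ x in E, f x ∂μ ≤ ∫ x in {x | 0 < f x}, f x ∂μ := by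
  rw [← sub_nonneg, setIntegral_pos_sub_setIntegral hf hfm hE]
  exact integral_nonneg (indicator_le_indicator_pos f E)

/-- The set where `f` is positive is, up to null sets, the only maximizer of `E ↦ ∫ x in E, f x`,
provided that `f` vanishes almost nowhere. -/
theorem ae_eq_pos_of_setIntegral_le (hf : Integrable f μ) (hfm : Measurable f) {E : Set α}
    (hE : MeasurableSet E) (h0 : μ {x | f x = 0} = 0)
    (h : ∫ x in {x | 0 < f x}, f x ∂μ ≤ ∫ x in E, f x ∂μ) : E =ᵐ[μ] {x | 0 < f x} := by
  have hP : MeasurableSet {x | 0 < f x} := measurableSet_lt measurable_const hfm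
  have hzero := le_antisymm (sub_nonpos.2 h)
    (sub_nonneg.2 (setIntegral_le_setIntegral_pos hf hfm hE))
  rw [setIntegral_pos_sub_setIntegral hf hfm hE, integral_eq_zero_iff_of_nonneg
    (indicator_le_indicator_pos f E) ((hf.indicator hP).sub (hf.indicator hE))] at hzero
  have hne : ∀ᵐ x ∂μ, f x ≠ 0 := by simpa [ae_iff] using h0
  filter_upwards [hzero, hne] with x hx hx0
  have hiff : x ∈ E ↔ x ∈ {x | 0 < f x} := by
    by_cases h1 : x ∈ E <;> by_cases h2 : 0 < f x <;>
      simp_all [Set.indicator]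
  exact propext hiff

end NeymanPearson

section Receiver

variable {n : ℕ} {Sigma : Matrix (Fin n) (Fin n) ℝ}

/-- The decision rule that decides for `j` on `E` and for the other hypothesis off `E`. -/
def ruleOn (j : Fin 2) {E : Set (EuclideanSpace ℝ (Fin n))} (hE : MeasurableSet E) :
    DecisionRule n :=
  open Classical in
  ⟨fun y ↦ if y ∈ E then j else 1 - j, Measurable.ite hE measurable_const measurable_const⟩

theorem ruleOn_eq_iff (j : Fin 2) {E : Set (EuclideanSpace ℝ (Fin n))} (hE : MeasurableSet E) :
    {y | (ruleOn j hE).1 y = j} = E := by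
  ext y
  have : 1 - j ≠ j := by fin_cases j <;> decide
  by_cases hy : y ∈ E <;> simp [ruleOn, hy, this]

theorem condProb_ruleOn (S : Signals n) (i j : Fin 2) {E : Set (EuclideanSpace ℝ (Fin n))}
    (hE : MeasurableSet E) :
    condProb Sigma S (ruleOn j hE) j i = (multivariateGaussian (S i) Sigma).real E := by
  rw [condProb, ruleOn_eq_iff]

theorem measurableSet_decision (δ : DecisionRule n) (j : Fin 2) :
    MeasurableSet {y | δ.1 y = j} :=
  δ.2 (measurableSet_singleton j)

theorem condProb_zero_add_one (S : Signals n) (δ : DecisionRule n) (i : Fin 2) :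
    condProb Sigma S δ 0 i + condProb Sigma S δ 1 i = 1 := by
  have h : {y | δ.1 y = 1} = {y | δ.1 y = 0}ᶜ := by
    ext y
    simp only [Set.mem_ofPred_eq, Set.mem_compl_iff]
    omega
  rw [condProb, condProb, h]
  exact probReal_add_probReal_compl (measurableSet_decision δ 0)

theorem condProb_other (S : Signals n) (δ : DecisionRule n) (i j : Fin 2) :
    condProb Sigma S δ (1 - j) i = 1 - condProb Sigma S δ j i := by
  have := condProb_zero_add_one (Sigma := Sigma) S δ i
  fin_cases j
  · simp; linarith
  · simp; linarith

theorem condProb_of_eq {S : Signals n} (h : S 0 = S 1) (δ : DecisionRule n) (j : Fin 2) :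
    condProb Sigma S δ j 0 = condProb Sigma S δ j 1 := by
  rw [condProb, condProb, h]

theorem condProb_le_one (S : Signals n) (δ : DecisionRule n) (j i : Fin 2) :
    condProb Sigma S δ j i ≤ 1 := measureReal_le_one

theorem bayesRisk_eq_one (p : Player) (S : Signals n) (δ : DecisionRule n) :
    bayesRisk p Sigma S δ = p.prior 0 * p.cost 0 0 + p.prior 1 * p.cost 0 1 +
      (tauNum p * condProb Sigma S δ 1 0 - tauDen p * condProb Sigma S δ 1 1) := by
  have h0 := condProb_zero_add_one (Sigma := Sigma) S δ 0
  have h1 := condProb_zero_add_one (Sigma := Sigma) S δ 1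
  simp only [bayesRisk, Fin.sum_univ_two, tauNum, tauDen]
  rw [eq_sub_of_add_eq h0, eq_sub_of_add_eq h1]
  ring

theorem bayesRisk_eq_zero (p : Player) (S : Signals n) (δ : DecisionRule n) :
    bayesRisk p Sigma S δ = p.prior 0 * p.cost 1 0 + p.prior 1 * p.cost 1 1 -
      (tauNum p * condProb Sigma S δ 0 0 - tauDen p * condProb Sigma S δ 0 1) := by
  have h0 := condProb_zero_add_one (Sigma := Sigma) S δ 0
  have h1 := condProb_zero_add_one (Sigma := Sigma) S δ 1
  simp only [bayesRisk, Fin.sum_univ_two, tauNum, tauDen]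
  rw [eq_sub_of_add_eq' h0, eq_sub_of_add_eq' h1]
  ring

theorem prior_one_pos {r : Player} (hD : tauDen r ≠ 0) : 0 < r.prior 1 :=
  (r.prior_nonneg 1).lt_of_ne' fun h ↦ hD (by simp [tauDen, h])

theorem zeta_mul_tauDen_pos {r : Player} (hD : tauDen r ≠ 0) : 0 < zeta r * tauDen r := by
  have h1 := prior_one_pos hD
  rcases lt_trichotomy (r.cost 0 1 - r.cost 1 1) 0 with h | h | h
  · rw [zeta, Real.sign_of_neg h, tauDen]
    nlinarith
  · exact absurd (by simp [tauDen, h]) hD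
  · rw [zeta, Real.sign_of_pos h, tauDen]
    nlinarith

/-- `j` is the hypothesis for which the receiver `r` decides when the likelihood ratio exceeds its
threshold: `1` if `zeta r = 1` and `0` if `zeta r = -1`. This is encoded by what is used of it: in
terms of the probabilities of deciding for `j`, the risk of every player has the same form for both
signs. -/
def IsFavoured (Sigma : Matrix (Fin n) (Fin n) ℝ) (r : Player) (j : Fin 2) : Prop :=
  ∀ p : Player, ∃ c : ℝ, ∀ S δ, bayesRisk p Sigma S δ = c +
    zeta r * (tauNum p * condProb Sigma S δ j 0 - tauDen p * condProb Sigma S δ j 1)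

theorem exists_isFavoured {r : Player} (hD : tauDen r ≠ 0) : ∃ j, IsFavoured Sigma r j := by
  rcases lt_trichotomy (r.cost 0 1 - r.cost 1 1) 0 with h | h | h
  · refine ⟨0, fun p ↦ ⟨p.prior 0 * p.cost 1 0 + p.prior 1 * p.cost 1 1, fun S δ ↦ ?_⟩⟩
    rw [zeta, Real.sign_of_neg h, bayesRisk_eq_zero, sub_eq_add_neg, neg_one_mul]
  · exact absurd (by simp [tauDen, h]) hD
  · refine ⟨1, fun p ↦ ⟨p.prior 0 * p.cost 0 0 + p.prior 1 * p.cost 0 1, fun S δ ↦ ?_⟩⟩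
    rw [zeta, Real.sign_of_pos h, bayesRisk_eq_one, one_mul]

theorem isBestResponse_iff {r : Player} (hD : tauDen r ≠ 0) {j : Fin 2}
    (hj : IsFavoured Sigma r j) (S : Signals n) (δ : DecisionRule n) :
    IsBestResponse r Sigma S δ ↔ ∀ η : DecisionRule n,
      condProb Sigma S η j 1 - tau r * condProb Sigma S η j 0 ≤
        condProb Sigma S δ j 1 - tau r * condProb Sigma S δ j 0 := by
  obtain ⟨c, hc⟩ := hj r
  have hpos := zeta_mul_tauDen_pos hD
  have h (η : DecisionRule n) : bayesRisk r Sigma S η = c - zeta r * tauDen r *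
      (condProb Sigma S η j 1 - tau r * condProb Sigma S η j 0) := by
    rw [hc, tau]
    field_simp
    ring
  simp only [IsBestResponse, h]
  refine forall_congr' fun η ↦ ?_
  rw [sub_le_sub_iff_left, mul_le_mul_iff_right₀ hpos]

section Test

variable (S : Signals n) (τ : ℝ)

theorem integrable_excess (hSigma : Sigma.PosDef) :
    Integrable (fun y ↦ Real.exp (logLikelihood Sigma S y) - τ)
      (multivariateGaussian (S 0) Sigma) :=
  (integrable_exp_logLikelihood hSigma S).sub (integrable_const τ)

theorem measurable_excess : Measurable (fun y ↦ Real.exp (logLikelihood Sigma S y) - τ) :=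
  (measurable_logLikelihood S).exp.sub_const τ

theorem condProb_sub_eq_setIntegral (hSigma : Sigma.PosDef) (δ : DecisionRule n) (j : Fin 2) :
    condProb Sigma S δ j 1 - τ * condProb Sigma S δ j 0 =
      ∫ y in {y | δ.1 y = j}, (Real.exp (logLikelihood Sigma S y) - τ)
        ∂(multivariateGaussian (S 0) Sigma) := by
  rw [integral_sub (integrable_exp_logLikelihood hSigma S).integrableOn (integrable_const τ),
    ← multivariateGaussian_real_eq_setIntegral hSigma S (measurableSet_decision δ j),
    setIntegral_const, smul_eq_mul, mul_comm τ]
  rfl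

variable {τ}

theorem excess_pos_iff (hτ : 0 < τ) (y : EuclideanSpace ℝ (Fin n)) :
    0 < Real.exp (logLikelihood Sigma S y) - τ ↔ Real.log τ < logLikelihood Sigma S y := by
  rw [sub_pos, Real.log_lt_iff_lt_exp hτ]

theorem excess_eq_zero_iff (hτ : 0 < τ) (y : EuclideanSpace ℝ (Fin n)) :
    Real.exp (logLikelihood Sigma S y) - τ = 0 ↔ logLikelihood Sigma S y = Real.log τ := by
  constructor
  · intro h
    rw [← sub_eq_zero.1 h, Real.log_exp]
  · intro h
    rw [h, Real.exp_log hτ, sub_self]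

end Test

variable {r : Player} {j : Fin 2} {S : Signals n} {δ : DecisionRule n}

/-- The probabilities of the decisions of an optimal receiver, unless it is indifferent. -/
theorem condProb_of_isBestResponse (hSigma : Sigma.PosDef) (hD : tauDen r ≠ 0) (hτ : 0 < tau r)
    (hj : IsFavoured Sigma r j) (h : signalDist Sigma S ≠ 0 ∨ Real.log (tau r) ≠ 0)
    (hδ : IsBestResponse r Sigma S δ) (i : Fin 2) :
    condProb Sigma S δ j i = exceedProb i (Real.log (tau r)) (signalDist Sigma S) := by
  have hP : MeasurableSet {y | 0 < Real.exp (logLikelihood Sigma S y) - tau r} :=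
    measurableSet_lt measurable_const (measurable_excess S (tau r))
  have hopt := (isBestResponse_iff hD hj S δ).1 hδ (ruleOn j hP)
  rw [condProb_sub_eq_setIntegral S _ hSigma, condProb_sub_eq_setIntegral S _ hSigma] at hopt
  rw [ruleOn_eq_iff] at hopt
  have hae := ae_eq_pos_of_setIntegral_le (integrable_excess S _ hSigma) (measurable_excess S _)
    (measurableSet_decision δ j) (by
      simp_rw [excess_eq_zero_iff S hτ]
      exact measure_logLikelihood_eq hSigma S h) hopt
  simp_rw [excess_pos_iff S hτ] at hae
  rw [condProb, ← multivariateGaussian_real_lt_logLikelihood hSigma S h]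
  refine measureReal_congr ?_
  fin_cases i
  · exact hae
  · exact (multivariateGaussian_absolutelyContinuous hSigma S).ae_eq hae

theorem isBestResponse_of_indifferent (hD : tauDen r ≠ 0) (hj : IsFavoured Sigma r j)
    (hS : S 0 = S 1) (hτ : tau r = 1) (δ : DecisionRule n) : IsBestResponse r Sigma S δ := by
  rw [isBestResponse_iff hD hj]
  intro η
  simp [hτ, condProb_of_eq hS]

theorem exists_isBestResponse (hSigma : Sigma.PosDef) (hD : tauDen r ≠ 0)
    (hj : IsFavoured Sigma r j) (S : Signals n) : ∃ δ, IsBestResponse r Sigma S δ := by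
  have hP : MeasurableSet {y | 0 < Real.exp (logLikelihood Sigma S y) - tau r} :=
    measurableSet_lt measurable_const (measurable_excess S (tau r))
  refine ⟨ruleOn j hP, (isBestResponse_iff hD hj S _).2 fun η ↦ ?_⟩
  rw [condProb_ruleOn, condProb_ruleOn, multivariateGaussian_real_eq_setIntegral hSigma S hP]
  have h2 := setIntegral_le_setIntegral_pos (integrable_excess S (tau r) hSigma)
    (measurable_excess S _) (measurableSet_decision η j)
  rw [← condProb_sub_eq_setIntegral S _ hSigma,
    integral_sub (integrable_exp_logLikelihood hSigma S).integrableOn (integrable_const _),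
    setIntegral_const, smul_eq_mul, mul_comm _ (tau r)] at h2
  exact h2

/-- The receiver is indifferent only if the signals agree and the threshold is one: otherwise the
two constant rules cannot both be optimal, the optimal decision being almost surely unique. -/
theorem indifferent_iff (hSigma : Sigma.PosDef) (hD : tauDen r ≠ 0) (hτ : 0 < tau r) :
    (∀ η : DecisionRule n, IsBestResponse r Sigma S η) ↔ S 0 = S 1 ∧ tau r = 1 := by
  obtain ⟨j, hj⟩ := exists_isFavoured (Sigma := Sigma) hD
  refine ⟨fun h ↦ ?_, fun h ↦ isBestResponse_of_indifferent hD hj h.1 h.2⟩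
  by_contra hcon
  have hne : signalDist Sigma S ≠ 0 ∨ Real.log (tau r) ≠ 0 := by
    by_contra! h0
    rw [signalDist_eq_zero_iff hSigma] at h0
    exact hcon ⟨h0.1, Real.eq_one_of_pos_of_log_eq_zero hτ h0.2⟩
  have h1 := condProb_of_isBestResponse hSigma hD hτ hj hne (h (ruleOn j .univ)) 0
  have h2 := condProb_of_isBestResponse hSigma hD hτ hj hne (h (ruleOn j .empty)) 0
  rw [condProb_ruleOn] at h1 h2
  simp at h1 h2
  linarith

theorem exists_reaction_breaksTiesEvenly [NeZero n] (hSigma : Sigma.PosDef) (P : Fin 2 → ℝ)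
    (hD : tauDen r ≠ 0) (hτ : 0 < tau r) :
    ∃ ρ : Signals n → DecisionRule n, IsReaction r Sigma P ρ ∧ BreaksTiesEvenly r Sigma P ρ := by
  obtain ⟨j, hj⟩ := exists_isFavoured (Sigma := Sigma) hD
  have h (S : Signals n) : ∃ δ, IsBestResponse r Sigma S δ ∧
      (S 0 = S 1 ∧ tau r = 1 → ∀ j i, condProb Sigma S δ j i = 1 / 2) := by
    by_cases hS : S 0 = S 1 ∧ tau r = 1
    · obtain ⟨E, hE, hE2⟩ := exists_measurableSet_multivariateGaussian_eq_half hSigma (S 0)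
      refine ⟨ruleOn 0 hE, isBestResponse_of_indifferent hD hj hS.1 hS.2 _, fun _ ↦ ?_⟩
      have h0 : ∀ i, condProb Sigma S (ruleOn 0 hE) 0 i = 1 / 2 := by
        rw [Fin.forall_fin_two, condProb_ruleOn, condProb_ruleOn, ← hS.1]
        exact ⟨hE2, hE2⟩
      rw [Fin.forall_fin_two]
      refine ⟨h0, fun i ↦ ?_⟩
      have := condProb_zero_add_one (Sigma := Sigma) S (ruleOn 0 hE) i
      linarith [h0 i]
    · obtain ⟨δ, hδ⟩ := exists_isBestResponse hSigma hD hj S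
      exact ⟨δ, hδ, fun h ↦ absurd h hS⟩
  choose ρ h1 h2 using h
  exact ⟨ρ, fun S _ ↦ h1 S, fun S _ hS ↦ h2 S ((indifferent_iff hSigma hD hτ).1 hS)⟩

end Receiver

/-! ### The attainable distances -/

section Distances

variable {n : ℕ} {Sigma : Matrix (Fin n) (Fin n) ℝ} {lam : ℝ} {P : Fin 2 → ℝ}

theorem minEigenvalue_pos (hSigma : Sigma.PosDef)
    (hlam : Module.End.HasEigenvalue (Matrix.toLin' Sigma) lam) : 0 < lam := by
  obtain ⟨v, hv⟩ := hlam.exists_hasEigenvector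
  have h := hSigma.dotProduct_mulVec_pos hv.2
  have h2 := hv.apply_eq_smul
  rw [Matrix.toLin'_apply] at h2
  rw [h2, star_trivial, dotProduct_smul, smul_eq_mul] at h
  have h3 : 0 ≤ v ⬝ᵥ v := by simpa using dotProduct_star_self_nonneg v
  exact pos_of_mul_pos_left h h3

open scoped MatrixOrder in
/-- The Rayleigh quotient is at least the minimal eigenvalue. -/
theorem minEigenvalue_mul_le (hSigma : Sigma.PosDef)
    (hlam : IsLeast {μ : ℝ | Module.End.HasEigenvalue (Matrix.toLin' Sigma) μ} lam)
    (v : Fin n → ℝ) : lam * (v ⬝ᵥ v) ≤ v ⬝ᵥ Sigma *ᵥ v := by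
  have hle : algebraMap ℝ (Matrix (Fin n) (Fin n) ℝ) lam ≤ Sigma := by
    rw [algebraMap_le_iff_le_spectrum (ha := hSigma.isHermitian.isSelfAdjoint)]
    intro x hx
    refine hlam.2 ?_
    rw [← Matrix.spectrum_toLin'] at hx
    exact Module.End.hasEigenvalue_iff_mem_spectrum.2 hx
  have h := (Matrix.le_iff.1 hle).dotProduct_mulVec_nonneg v
  rw [star_trivial, sub_mulVec, dotProduct_sub, Algebra.algebraMap_eq_smul_one, smul_mulVec,
    one_mulVec, dotProduct_smul, smul_eq_mul] at h
  linarith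

/-- For `x = S₁ - S₀` and `w = Σ⁻¹ x`, the quantity `d² = ⟪w, x⟫` is at most `‖w‖ ‖x‖`, while
`lam ‖w‖² ≤ ⟪w, Σ w⟫ = d²`. -/
theorem sq_signalDist_le (hSigma : Sigma.PosDef)
    (hlam : IsLeast {μ : ℝ | Module.End.HasEigenvalue (Matrix.toLin' Sigma) μ} lam)
    (S : Signals n) : signalDist Sigma S ^ 2 ≤ ‖S 1 - S 0‖ ^ 2 / lam := by
  have hl := minEigenvalue_pos hSigma hlam.1
  set w := matchedFilter Sigma S with hw
  have h1 := minEigenvalue_mul_le hSigma hlam w.ofLp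
  rw [matchedFilter_variance hSigma] at h1
  have h2 : w.ofLp ⬝ᵥ w.ofLp = ‖w‖ ^ 2 := by
    rw [← real_inner_self_eq_norm_sq, EuclideanSpace.inner_eq_star_dotProduct, star_trivial]
  have h3 := real_inner_le_norm w (S 1 - S 0)
  rw [inner_matchedFilter_sub hSigma] at h3
  rw [h2] at h1
  rw [le_div_iff₀ hl]
  set q := signalDist Sigma S ^ 2 with hq
  have hq0 : 0 ≤ q := sq_nonneg _
  rcases hq0.eq_or_lt with h0 | h0
  · rw [← h0, zero_mul]
    positivity
  · have h4 : q ^ 2 ≤ ‖w‖ ^ 2 * ‖S 1 - S 0‖ ^ 2 := by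
      rw [← mul_pow]
      exact pow_le_pow_left₀ hq0 h3 2
    have h5 : q * (q * lam) ≤ q * ‖S 1 - S 0‖ ^ 2 := by
      nlinarith [sq_nonneg ‖S 1 - S 0‖]
    exact le_of_mul_le_mul_left h5 h0

theorem dMax_eq (P : Fin 2 → ℝ) (lam : ℝ) :
    dMax P lam = (Real.sqrt (P 0) + Real.sqrt (P 1)) / Real.sqrt lam := by
  rw [dMax, Real.sqrt_div (sq_nonneg _), Real.sqrt_sq (by positivity)]

theorem norm_le_sqrt_of_mem_feasible {S : Signals n} (hS : S ∈ feasible n P) (i : Fin 2) :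
    ‖S i‖ ≤ Real.sqrt (P i) :=
  Real.le_sqrt_of_sq_le (hS i)

theorem signalDist_le_dMax (hSigma : Sigma.PosDef)
    (hlam : IsLeast {μ : ℝ | Module.End.HasEigenvalue (Matrix.toLin' Sigma) μ} lam)
    {S : Signals n} (hS : S ∈ feasible n P) : signalDist Sigma S ≤ dMax P lam := by
  have hl := minEigenvalue_pos hSigma hlam.1
  refine Real.le_sqrt_of_sq_le ((sq_signalDist_le hSigma hlam S).trans ?_)
  gcongr
  calc ‖S 1 - S 0‖ ≤ ‖S 1‖ + ‖S 0‖ := norm_sub_le _ _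
    _ ≤ Real.sqrt (P 0) + Real.sqrt (P 1) := by
      linarith [norm_le_sqrt_of_mem_feasible hS 0, norm_le_sqrt_of_mem_feasible hS 1]

variable {ν : EuclideanSpace ℝ (Fin n)} {s₀ s₁ : ℝ}

theorem signalsAlong_mem_feasible (hP : ∀ i, 0 ≤ P i) (hν : ν ≠ 0)
    (h0 : |s₀| ≤ Real.sqrt (P 0)) (h1 : |s₁| ≤ Real.sqrt (P 1)) :
    signalsAlong ν s₀ s₁ ∈ feasible n P := by
  have hn : ‖ν‖ ≠ 0 := norm_ne_zero_iff.2 hν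
  have h (s p : ℝ) (hp : 0 ≤ p) (hs : |s| ≤ Real.sqrt p) : ‖(s / ‖ν‖) • ν‖ ^ 2 ≤ p := by
    rw [norm_smul, norm_div, norm_norm, div_mul_cancel₀ _ hn, Real.norm_eq_abs,
      ← Real.le_sqrt (abs_nonneg _) hp]
    exact hs
  intro i
  fin_cases i
  · exact h s₀ _ (hP 0) h0
  · exact h s₁ _ (hP 1) h1

theorem signalDist_signalsAlong (hSigma : Sigma.PosDef)
    (hν : Module.End.HasEigenvector (Matrix.toLin' Sigma) lam ν.ofLp) (s₀ s₁ : ℝ) :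
    signalDist Sigma (signalsAlong ν s₀ s₁) = |s₁ - s₀| / Real.sqrt lam := by
  have hl := minEigenvalue_pos hSigma (Module.End.hasEigenvalue_of_hasEigenvector hν)
  have hν0 : ν ≠ 0 := fun h ↦ hν.2 (by simp [h])
  have hn : ‖ν‖ ≠ 0 := norm_ne_zero_iff.2 hν0
  have hdet := hSigma.isUnit
  rw [Matrix.isUnit_iff_isUnit_det] at hdet
  have hmul : Sigma *ᵥ ν.ofLp = lam • ν.ofLp := by
    simpa using hν.apply_eq_smul
  have hinv : Sigma⁻¹ *ᵥ ν.ofLp = lam⁻¹ • ν.ofLp := by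
    have : Sigma⁻¹ *ᵥ (Sigma *ᵥ ν.ofLp) = ν.ofLp := by
      rw [mulVec_mulVec, nonsing_inv_mul _ hdet, one_mulVec]
    rw [hmul, mulVec_smul] at this
    rw [← inv_smul_smul₀ hl.ne' (Sigma⁻¹ *ᵥ ν.ofLp), this]
  have hsub : (signalsAlong ν s₀ s₁ 1 - signalsAlong ν s₀ s₁ 0).ofLp =
      ((s₁ - s₀) / ‖ν‖) • ν.ofLp := by
    simp [signalsAlong, sub_div, sub_smul]
  have hself : ν.ofLp ⬝ᵥ ν.ofLp = ‖ν‖ ^ 2 := by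
    rw [← real_inner_self_eq_norm_sq, EuclideanSpace.inner_eq_star_dotProduct, star_trivial]
  rw [signalDist, hsub, mulVec_smul, hinv, smul_dotProduct, dotProduct_smul, dotProduct_smul,
    hself]
  have : ((s₁ - s₀) / ‖ν‖) • ((s₁ - s₀) / ‖ν‖) • lam⁻¹ • ‖ν‖ ^ 2 = (s₁ - s₀) ^ 2 / lam := by
    simp only [smul_eq_mul]
    field_simp
  rw [this, Real.sqrt_div (sq_nonneg _), Real.sqrt_sq_eq_abs]

/-- Every distance up to `dMax` is a difference of two admissible scalar signals. -/
theorem exists_scalars (hl : 0 < lam) {x : ℝ} (hx : x ∈ Set.Icc 0 (dMax P lam)) :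
    ∃ s₀ s₁ : ℝ, |s₀| ≤ Real.sqrt (P 0) ∧ |s₁| ≤ Real.sqrt (P 1) ∧
      |s₁ - s₀| = Real.sqrt lam * x := by
  have hsl := Real.sqrt_pos.2 hl
  have hle : Real.sqrt lam * x ≤ Real.sqrt (P 0) + Real.sqrt (P 1) := by
    have := hx.2
    rw [dMax_eq, le_div_iff₀ hsl] at this
    linarith
  have h0 := Real.sqrt_nonneg (P 0)
  have h1 := Real.sqrt_nonneg (P 1)
  have hnn : 0 ≤ Real.sqrt lam * x := mul_nonneg hsl.le hx.1
  -- the first signal takes as much of the required distance as its power permits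
  rcases le_total (Real.sqrt lam * x) (Real.sqrt (P 0)) with h | h
  · refine ⟨-(Real.sqrt lam * x), 0, ?_, ?_, ?_⟩
    · rwa [abs_neg, abs_of_nonneg hnn]
    · simp
    · rw [zero_sub, neg_neg, abs_of_nonneg hnn]
  · refine ⟨-Real.sqrt (P 0), Real.sqrt lam * x - Real.sqrt (P 0), ?_, ?_, ?_⟩
    · rw [abs_neg, abs_of_nonneg h0]
    · rw [abs_of_nonneg (sub_nonneg.2 h)]
      linarith
    · rw [sub_neg_eq_add, sub_add_cancel, abs_of_nonneg hnn]

end Distances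

/-! ### The transmitter's risk as a function of the distance -/

section DistanceRisk

open Filter Topology

/-- Up to an additive constant, the risk of the transmitter when the signals are at distance `d`
and the receiver compares the log-likelihood ratio with `L`. -/
def distanceRisk (A B L d : ℝ) : ℝ := A * exceedProb 0 L d - B * exceedProb 1 L d

theorem exceedProb_zero_left (i : Fin 2) (d : ℝ) :
    exceedProb i 0 d = Q ((-1) ^ (i : ℕ) * (d / 2)) := by
  by_cases hd : d = 0
  · simp [exceedProb, hd, Q_zero]
  · simp [exceedProb, hd]

theorem exceedProb_at_zero (i j : Fin 2) (L : ℝ) : exceedProb i L 0 = exceedProb j L 0 := by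
  simp [exceedProb]

theorem continuousWithinAt_exceedProb_zero (i : Fin 2) (L : ℝ) :
    ContinuousWithinAt (exceedProb i L) (Set.Ici 0) 0 := by
  rcases eq_or_ne L 0 with rfl | hL
  · simp_rw [funext (exceedProb_zero_left i)]
    exact (continuous_Q.comp (by fun_prop)).continuousWithinAt
  rw [← Set.Ioi_insert, continuousWithinAt_insert_self, ContinuousWithinAt]
  have heq : exceedProb i L =ᶠ[𝓝[>] 0] fun d ↦ Q (L / d + (-1) ^ (i : ℕ) * (d / 2)) := by
    filter_upwards [self_mem_nhdsWithin] with d hd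
    simp [exceedProb, (Set.mem_Ioi.1 hd).ne']
  have hlin : Tendsto (fun d : ℝ ↦ (-1) ^ (i : ℕ) * (d / 2)) (𝓝[>] 0) (𝓝 0) := by
    have : Continuous (fun d : ℝ ↦ (-1 : ℝ) ^ (i : ℕ) * (d / 2)) := by fun_prop
    have h := this.tendsto 0
    simp only [zero_div, mul_zero] at h
    exact h.mono_left nhdsWithin_le_nhds
  rw [tendsto_congr' heq]
  rcases lt_or_gt_of_ne hL with h | h
  · have h1 : Tendsto (fun d : ℝ ↦ L / d) (𝓝[>] 0) atBot := by
      simpa [div_eq_mul_inv] using tendsto_inv_nhdsGT_zero.const_mul_atTop_of_neg h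
    have h2 := tendsto_Q_atBot.comp (h1.atBot_add hlin)
    simpa [exceedProb, h, h.not_gt, Function.comp_def] using h2
  · have h1 : Tendsto (fun d : ℝ ↦ L / d) (𝓝[>] 0) atTop := by
      simpa [div_eq_mul_inv] using tendsto_inv_nhdsGT_zero.const_mul_atTop h
    have h2 := tendsto_Q_atTop.comp (h1.atTop_add hlin)
    simpa [exceedProb, h, Function.comp_def] using h2

theorem hasDerivAt_exceedProb (i : Fin 2) (L : ℝ) {d : ℝ} (hd : 0 < d) :
    HasDerivAt (exceedProb i L)
      (-(1 / Real.sqrt (2 * Real.pi) *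
          Real.exp (-(L / d + (-1) ^ (i : ℕ) * (d / 2)) ^ 2 / 2)) *
        (-L / d ^ 2 + (-1) ^ (i : ℕ) * (1 / 2))) d := by
  have heq : exceedProb i L =ᶠ[𝓝 d] fun d ↦ Q (L / d + (-1) ^ (i : ℕ) * (d / 2)) := by
    filter_upwards [lt_mem_nhds hd] with x hx
    simp [exceedProb, hx.ne']
  refine HasDerivAt.congr_of_eventuallyEq ?_ heq
  refine (hasDerivAt_Q _).comp d ?_
  have h1 : HasDerivAt (fun d : ℝ ↦ L / d) (-L / d ^ 2) d := by
    exact ((hasDerivAt_const d L).div (hasDerivAt_id d) hd.ne').congr_deriv (by simp)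
  exact h1.add (((hasDerivAt_id d).div_const 2).const_mul _)

variable (A B L : ℝ)

theorem continuousOn_distanceRisk : ContinuousOn (distanceRisk A B L) (Set.Ici 0) := by
  have h (i : Fin 2) : ContinuousOn (exceedProb i L) (Set.Ici 0) := by
    intro d hd
    rcases (Set.mem_Ici.1 hd).eq_or_lt with rfl | hd
    · exact continuousWithinAt_exceedProb_zero i L
    · exact (hasDerivAt_exceedProb i L hd).continuousAt.continuousWithinAt
  exact ((h 0).const_smul A).sub ((h 1).const_smul B)

/-- The sign of the derivative is that of `2 L (k₀ - k₁) - (k₀ + k₁) d²`, where `k₀ = A e^{-L/2}`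
and `k₁ = B e^{L/2}`: the two Gaussian densities involved differ by the factor `e^L`. -/
theorem hasDerivAt_distanceRisk {d : ℝ} (hd : 0 < d) :
    HasDerivAt (distanceRisk A B L)
      (1 / Real.sqrt (2 * Real.pi) * Real.exp (-((L / d) ^ 2 + (d / 2) ^ 2) / 2) / (2 * d ^ 2) *
        (2 * L * (A * Real.exp (-L / 2) - B * Real.exp (L / 2)) -
          (A * Real.exp (-L / 2) + B * Real.exp (L / 2)) * d ^ 2)) d := by
  have h := ((hasDerivAt_exceedProb 0 L hd).const_mul A).sub
    ((hasDerivAt_exceedProb 1 L hd).const_mul B)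
  refine h.congr_deriv ?_
  have e0 : Real.exp (-(L / d + (-1) ^ ((0 : Fin 2) : ℕ) * (d / 2)) ^ 2 / 2) =
      Real.exp (-((L / d) ^ 2 + (d / 2) ^ 2) / 2) * Real.exp (-L / 2) := by
    rw [← Real.exp_add]
    congr 1
    simp
    field_simp
    ring
  have e1 : Real.exp (-(L / d + (-1) ^ ((1 : Fin 2) : ℕ) * (d / 2)) ^ 2 / 2) =
      Real.exp (-((L / d) ^ 2 + (d / 2) ^ 2) / 2) * Real.exp (L / 2) := by
    rw [← Real.exp_add]
    congr 1
    simp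
    field_simp
    ring
  rw [e0, e1]
  simp
  field_simp
  ring

variable {A B L}

theorem distanceRisk_strictAntiOn {a b : ℝ} (ha : 0 ≤ a)
    (h : ∀ d ∈ Set.Ioo a b, 2 * L * (A * Real.exp (-L / 2) - B * Real.exp (L / 2)) -
      (A * Real.exp (-L / 2) + B * Real.exp (L / 2)) * d ^ 2 < 0) :
    StrictAntiOn (distanceRisk A B L) (Set.Icc a b) := by
  refine strictAntiOn_of_deriv_neg (convex_Icc a b)
    ((continuousOn_distanceRisk A B L).mono fun x hx ↦ ha.trans hx.1) fun d hd ↦ ?_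
  rw [interior_Icc] at hd
  have hd0 : 0 < d := ha.trans_lt hd.1
  rw [(hasDerivAt_distanceRisk A B L hd0).deriv]
  exact mul_neg_of_pos_of_neg (by positivity) (h d hd)

theorem distanceRisk_strictMonoOn {a b : ℝ} (ha : 0 ≤ a)
    (h : ∀ d ∈ Set.Ioo a b, 0 < 2 * L * (A * Real.exp (-L / 2) - B * Real.exp (L / 2)) -
      (A * Real.exp (-L / 2) + B * Real.exp (L / 2)) * d ^ 2) :
    StrictMonoOn (distanceRisk A B L) (Set.Icc a b) := by
  refine strictMonoOn_of_deriv_pos (convex_Icc a b)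
    ((continuousOn_distanceRisk A B L).mono fun x hx ↦ ha.trans hx.1) fun d hd ↦ ?_
  rw [interior_Icc] at hd
  have hd0 : 0 < d := ha.trans_lt hd.1
  rw [(hasDerivAt_distanceRisk A B L hd0).deriv]
  exact mul_pos (by positivity) (h d hd)

theorem distanceRisk_eq_of_zero
    (h1 : 2 * L * (A * Real.exp (-L / 2) - B * Real.exp (L / 2)) = 0)
    (h2 : A * Real.exp (-L / 2) + B * Real.exp (L / 2) = 0) {x y : ℝ} (hx : 0 ≤ x) (hy : 0 ≤ y) :
    distanceRisk A B L x = distanceRisk A B L y := by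
  have hderiv : ∀ d ∈ interior (Set.Ici (0 : ℝ)), HasDerivAt (distanceRisk A B L) 0 d := by
    intro d hd
    rw [interior_Ici] at hd
    simpa [h1, h2] using hasDerivAt_distanceRisk A B L (Set.mem_Ioi.1 hd)
  have hdiff : DifferentiableOn ℝ (distanceRisk A B L) (interior (Set.Ici 0)) := fun d hd ↦
    (hderiv d hd).differentiableAt.differentiableWithinAt
  have hmono := monotoneOn_of_deriv_nonneg (convex_Ici 0) (continuousOn_distanceRisk A B L) hdiff
    fun d hd ↦ (hderiv d hd).deriv.ge
  have hanti := antitoneOn_of_deriv_nonpos (convex_Ici 0) (continuousOn_distanceRisk A B L) hdiff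
    fun d hd ↦ (hderiv d hd).deriv.le
  rcases le_total x y with h | h
  · exact (hmono hx hy h).antisymm (hanti hx hy h)
  · exact (hanti hy hx h).antisymm (hmono hy hx h)

theorem distanceRisk_sub_zero_of_pos (hL : 0 < L) {d : ℝ} (hd : d ≠ 0) :
    distanceRisk A B L d - distanceRisk A B L 0 =
      A * Q (L / d + d / 2) - B * Q (L / d - d / 2) := by
  simp [distanceRisk, exceedProb, hL, hd, sub_eq_add_neg]

theorem distanceRisk_sub_zero_of_neg (hL : L < 0) {d : ℝ} (hd : d ≠ 0) :
    distanceRisk A B L d - distanceRisk A B L 0 =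
      B * Q (-L / d + d / 2) - A * Q (-L / d - d / 2) := by
  have h0 := Q_neg (L / d + d / 2)
  have h1 := Q_neg (L / d - d / 2)
  rw [show -(L / d + d / 2) = -L / d - d / 2 by ring] at h0
  rw [show -(L / d - d / 2) = -L / d + d / 2 by ring] at h1
  simp only [distanceRisk, exceedProb, hL, hL.not_gt, hd, if_true, if_false, Fin.val_zero,
    Fin.val_one, pow_zero, pow_one, one_mul, neg_one_mul, ← sub_eq_add_neg, h0, h1]
  ring

theorem distanceRisk_sub_zero_of_zero (d : ℝ) :
    distanceRisk A B 0 d - distanceRisk A B 0 0 =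
      (A + B) / 2 * (Q (d / 2) - Q (-(d / 2))) := by
  have := Q_neg (d / 2)
  simp only [distanceRisk, exceedProb_zero_left, zero_div, mul_zero, Q_zero, Fin.val_zero,
    Fin.val_one, pow_zero, pow_one, one_mul, neg_one_mul, this]
  ring

end DistanceRisk

section Minimizers

/-- The points of `[0, M]` at which `g` attains its minimum over `[0, M]`. -/
def minimizers (g : ℝ → ℝ) (M : ℝ) : Set ℝ :=
  {x | x ∈ Set.Icc 0 M ∧ ∀ y ∈ Set.Icc 0 M, g x ≤ g y}

variable {g : ℝ → ℝ} {M m : ℝ}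

/-- A function decreasing up to `m` and increasing afterwards is minimal at `m` only. -/
theorem minimizers_of_anti_mono (hm : m ∈ Set.Icc 0 M) (h1 : StrictAntiOn g (Set.Icc 0 m))
    (h2 : StrictMonoOn g (Set.Icc m M)) : minimizers g M = {m} := by
  have key : ∀ y ∈ Set.Icc 0 M, y ≠ m → g m < g y := fun y hy hne ↦ by
    rcases lt_or_gt_of_ne hne with h | h
    · exact h1 ⟨hy.1, h.le⟩ ⟨hm.1, le_rfl⟩ h
    · exact h2 ⟨le_rfl, hm.2⟩ ⟨h.le, hy.2⟩ h
  ext x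
  constructor
  · intro hx
    by_contra hne
    exact (key x hx.1 hne).not_ge (hx.2 m hm)
  · rintro rfl
    refine ⟨hm, fun y hy ↦ ?_⟩
    rcases eq_or_ne y x with rfl | hne
    · exact le_rfl
    · exact (key y hy hne).le

theorem minimizers_of_anti (hM : 0 ≤ M) (h : StrictAntiOn g (Set.Icc 0 M)) :
    minimizers g M = {M} :=
  minimizers_of_anti_mono ⟨hM, le_rfl⟩ h (by simp [StrictMonoOn])

theorem minimizers_of_mono (hM : 0 ≤ M) (h : StrictMonoOn g (Set.Icc 0 M)) :
    minimizers g M = {0} :=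
  minimizers_of_anti_mono ⟨le_rfl, hM⟩ (by simp [StrictAntiOn]) h

/-- A function increasing up to `m` and decreasing afterwards is minimal at end points only. -/
theorem minimizers_of_mono_anti (hm : m ∈ Set.Icc 0 M) (h1 : StrictMonoOn g (Set.Icc 0 m))
    (h2 : StrictAntiOn g (Set.Icc m M)) :
    (g M < g 0 → minimizers g M = {M}) ∧ (g 0 < g M → minimizers g M = {0}) ∧
      (g M = g 0 → minimizers g M = {0, M}) := by
  have h0 : (0 : ℝ) ∈ Set.Icc 0 M := ⟨le_rfl, hm.1.trans hm.2⟩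
  have hM : M ∈ Set.Icc 0 M := ⟨hm.1.trans hm.2, le_rfl⟩
  have key : ∀ y ∈ Set.Icc 0 M, y ≠ 0 → y ≠ M → min (g 0) (g M) < g y := fun y hy hy0 hyM ↦ by
    rcases le_total y m with h | h
    · exact (min_le_left _ _).trans_lt (h1 ⟨le_rfl, hm.1⟩ ⟨hy.1, h⟩ (hy.1.lt_of_ne' hy0))
    · exact (min_le_right _ _).trans_lt (h2 ⟨h, hy.2⟩ ⟨hm.2, le_rfl⟩ (hy.2.lt_of_ne hyM))
  have key' : ∀ y ∈ Set.Icc 0 M, min (g 0) (g M) ≤ g y := fun y hy ↦ by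
    by_cases hy0 : y = 0
    · exact hy0 ▸ min_le_left _ _
    by_cases hyM : y = M
    · exact hyM ▸ min_le_right _ _
    exact (key y hy hy0 hyM).le
  have hiff : ∀ x, x ∈ minimizers g M ↔ (x = 0 ∨ x = M) ∧ g x = min (g 0) (g M) := fun x ↦ by
    constructor
    · intro hx
      have hle : g x ≤ min (g 0) (g M) := le_min (hx.2 0 h0) (hx.2 M hM)
      refine ⟨?_, hle.antisymm (key' x hx.1)⟩
      by_contra! hne
      exact (key x hx.1 hne.1 hne.2).not_ge hle
    · rintro ⟨rfl | rfl, hx⟩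
      · exact ⟨h0, fun y hy ↦ hx ▸ key' y hy⟩
      · exact ⟨hM, fun y hy ↦ hx ▸ key' y hy⟩
  refine ⟨fun h ↦ ?_, fun h ↦ ?_, fun h ↦ ?_⟩
  · ext x
    rw [hiff, min_eq_right h.le, Set.mem_singleton_iff]
    constructor
    · rintro ⟨rfl | rfl, hx⟩
      · exact absurd hx h.ne'
      · rfl
    · rintro rfl
      exact ⟨Or.inr rfl, rfl⟩
  · ext x
    rw [hiff, min_eq_left h.le, Set.mem_singleton_iff]
    constructor
    · rintro ⟨rfl | rfl, hx⟩
      · rfl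
      · exact absurd hx h.ne'
    · rintro rfl
      exact ⟨Or.inl rfl, rfl⟩
  · ext x
    rw [hiff, h, min_self, Set.mem_insert_iff, Set.mem_singleton_iff]
    exact and_iff_left_of_imp fun hx ↦ by rcases hx with rfl | rfl <;> simp [h]

theorem minimizers_of_const (h : ∀ x ∈ Set.Icc 0 M, ∀ y ∈ Set.Icc 0 M, g x = g y) :
    minimizers g M = Set.Icc 0 M := by
  ext x
  exact ⟨fun hx ↦ hx.1, fun hx ↦ ⟨hx, fun y hy ↦ (h x hx y hy).le⟩⟩

end Minimizers

/-! ### Degenerate likelihood ratio tests -/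

section Degenerate

variable {n : ℕ} {Sigma : Matrix (Fin n) (Fin n) ℝ} {P : Fin 2 → ℝ} {r : Player}

/-- If the likelihood ratio test degenerates, the receiver's risk decreases in both probabilities
of deciding for one and the same hypothesis `j`. -/
theorem exists_dominant_decision
    (h : (tauDen r ≠ 0 ∧ tau r ≤ 0) ∨ (tauDen r = 0 ∧ tauNum r ≠ 0)) :
    ∃ (j : Fin 2) (a b c : ℝ), 0 ≤ a ∧ 0 ≤ b ∧ 0 < a + b ∧ ∀ (S : Signals n) δ,
      bayesRisk r Sigma S δ = c - (a * condProb Sigma S δ j 0 + b * condProb Sigma S δ j 1) := by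
  have hcase : (tauNum r ≤ 0 ∧ 0 ≤ tauDen r ∨ 0 ≤ tauNum r ∧ tauDen r ≤ 0) ∧
      (tauNum r ≠ 0 ∨ tauDen r ≠ 0) := by
    rcases h with ⟨h1, h2⟩ | ⟨h1, h2⟩
    · exact ⟨(div_nonpos_iff.1 h2).symm, Or.inr h1⟩
    · refine ⟨?_, Or.inl h2⟩
      rcases le_total (tauNum r) 0 with h | h
      · exact Or.inl ⟨h, h1.ge⟩
      · exact Or.inr ⟨h, h1.le⟩
  obtain ⟨⟨hN, hD⟩ | ⟨hN, hD⟩, hne⟩ := hcase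
  · refine ⟨1, -tauNum r, tauDen r, r.prior 0 * r.cost 0 0 + r.prior 1 * r.cost 0 1,
      neg_nonneg.2 hN, hD, ?_, fun S δ ↦ ?_⟩
    · rcases hne with h | h
      · have := hN.lt_of_ne h
        linarith
      · have := hD.lt_of_ne' h
        linarith
    · rw [bayesRisk_eq_one]
      ring
  · refine ⟨0, tauNum r, -tauDen r, r.prior 0 * r.cost 1 0 + r.prior 1 * r.cost 1 1, hN,
      neg_nonneg.2 hD, ?_, fun S δ ↦ ?_⟩
    · rcases hne with h | h
      · have := hN.lt_of_ne' h
        linarith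
      · have := hD.lt_of_ne h
        linarith
    · rw [bayesRisk_eq_zero]
      ring

theorem condProb_eq_one_iff (hSigma : Sigma.PosDef) (S : Signals n) (δ : DecisionRule n)
    (j : Fin 2) : condProb Sigma S δ j 0 = 1 ↔ condProb Sigma S δ j 1 = 1 := by
  have hac (S : Signals n) (h : condProb Sigma S δ j 0 = 1) : condProb Sigma S δ j 1 = 1 := by
    have h1 := (prob_compl_eq_zero_iff (measurableSet_decision δ j)).2
      ((ENNReal.toReal_eq_one_iff _).1 h)
    have h2 := multivariateGaussian_absolutelyContinuous hSigma S h1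
    rw [prob_compl_eq_zero_iff (measurableSet_decision δ j)] at h2
    exact (ENNReal.toReal_eq_one_iff _).2 h2
  -- the converse is the same statement with the signals exchanged
  exact ⟨hac S, hac ![S 1, S 0]⟩

theorem condProb_eq_one_of_dominant (hSigma : Sigma.PosDef) {j : Fin 2} {a b c : ℝ} (ha : 0 ≤ a)
    (hb : 0 ≤ b) (hab : 0 < a + b) (h : ∀ (S : Signals n) δ, bayesRisk r Sigma S δ =
      c - (a * condProb Sigma S δ j 0 + b * condProb Sigma S δ j 1))
    {S : Signals n} {δ : DecisionRule n} (hδ : IsBestResponse r Sigma S δ) (i : Fin 2) :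
    condProb Sigma S δ j i = 1 := by
  have hopt := hδ (ruleOn j .univ)
  rw [h, h, condProb_ruleOn, condProb_ruleOn, probReal_univ, probReal_univ] at hopt
  have h0 := condProb_le_one (Sigma := Sigma) S δ j 0
  have h1 := condProb_le_one (Sigma := Sigma) S δ j 1
  have hor : condProb Sigma S δ j 0 = 1 ∨ condProb Sigma S δ j 1 = 1 := by
    by_contra! hne
    have h0' := h0.lt_of_ne hne.1
    have h1' := h1.lt_of_ne hne.2
    rcases ha.eq_or_lt with ha' | ha'
    · nlinarith
    · nlinarith
  have hiff := condProb_eq_one_iff hSigma S δ j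
  fin_cases i
  · exact hor.elim id hiff.2
  · exact hor.elim hiff.1 id

end Degenerate

/-! ### Reduction to the distance and the table of minimizers -/

section Leader

variable {n : ℕ} {Sigma : Matrix (Fin n) (Fin n) ℝ} {P : Fin 2 → ℝ} {lam : ℝ} {t r : Player}

/-- The risk of the transmitter at distance `d`, up to an additive constant. -/
def leaderRisk (t r : Player) : ℝ → ℝ :=
  distanceRisk (zeta r * tauNum t) (zeta r * tauDen t) (Real.log (tau r))

theorem zeta_mul_tauNum_mul_exp (t : Player) (hτ : 0 < tau r) :
    zeta r * tauNum t * Real.exp (-Real.log (tau r) / 2) = k₀ t r := by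
  rw [k₀, tauNum, Real.rpow_def_of_pos hτ,
    show Real.log (tau r) * (-1 / 2) = -Real.log (tau r) / 2 by ring]
  ring

theorem zeta_mul_tauDen_mul_exp (t : Player) (hτ : 0 < tau r) :
    zeta r * tauDen t * Real.exp (Real.log (tau r) / 2) = k₁ t r := by
  rw [k₁, tauDen, Real.rpow_def_of_pos hτ,
    show Real.log (tau r) * (1 / 2) = Real.log (tau r) / 2 by ring]
  ring

theorem leaderRisk_strictAntiOn (hτ : 0 < tau r) {a b : ℝ} (ha : 0 ≤ a)
    (h : ∀ d ∈ Set.Ioo a b, 2 * Real.log (tau r) * (k₀ t r - k₁ t r) <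
      (k₀ t r + k₁ t r) * d ^ 2) : StrictAntiOn (leaderRisk t r) (Set.Icc a b) := by
  refine distanceRisk_strictAntiOn ha fun d hd ↦ ?_
  rw [zeta_mul_tauNum_mul_exp t hτ, zeta_mul_tauDen_mul_exp t hτ, sub_neg]
  exact h d hd

theorem leaderRisk_strictMonoOn (hτ : 0 < tau r) {a b : ℝ} (ha : 0 ≤ a)
    (h : ∀ d ∈ Set.Ioo a b, (k₀ t r + k₁ t r) * d ^ 2 <
      2 * Real.log (tau r) * (k₀ t r - k₁ t r)) : StrictMonoOn (leaderRisk t r) (Set.Icc a b) := by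
  refine distanceRisk_strictMonoOn ha fun d hd ↦ ?_
  rw [zeta_mul_tauNum_mul_exp t hτ, zeta_mul_tauDen_mul_exp t hτ, sub_pos]
  exact h d hd

/-- If the risk starts out nondecreasing but eventually decreases, the comparison of its values at
`d` and at `0` is decided by `decisionGap`. The factor `K` is the coefficient of the transmitter's
risk by which `decisionGap` is normalized; it is positive by the sign conditions. -/
theorem leaderRisk_sub_zero (hτ : 0 < tau r)
    (h : 0 ≤ Real.log (tau r) * (k₀ t r - k₁ t r)) (hs : 0 < k₀ t r + k₁ t r)
    {d : ℝ} (hd : d ≠ 0) :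
    ∃ K > 0, leaderRisk t r d - leaderRisk t r 0 = -(K * decisionGap t r d) := by
  set L := Real.log (tau r) with hL
  set A := zeta r * tauNum t with hA
  set B := zeta r * tauDen t with hB
  set e := Real.exp (L / 2) with he
  have he0 : 0 < e := Real.exp_pos _
  have h0 : k₀ t r = A / e := by
    rw [← zeta_mul_tauNum_mul_exp t hτ, ← hL, ← hA, neg_div, Real.exp_neg, ← he]
    rfl
  have h1 : k₁ t r = B * e := (zeta_mul_tauDen_mul_exp t hτ).symm
  have hτe : tau r = e * e := by
    rw [← Real.exp_add, add_halves, hL, Real.exp_log hτ]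
  rcases lt_trichotomy L 0 with hneg | hzero | hpos
  · have hle : k₀ t r - k₁ t r ≤ 0 := nonpos_of_mul_nonneg_right h hneg
    have hB0 : 0 < B := by
      have : 0 < B * e := by linarith
      exact pos_of_mul_pos_left this he0.le
    refine ⟨B, hB0, ?_⟩
    rw [leaderRisk, ← hL, distanceRisk_sub_zero_of_neg hneg hd, decisionGap, ← hL, sign_neg hneg,
      abs_of_neg hneg, h0, h1, hτe, SignType.coe_neg_one, _root_.zpow_neg_one]
    field_simp
    ring
  · have hA0 : 0 < (A + B) / 2 := by
      have : e = 1 := by rw [he, hzero, zero_div, Real.exp_zero]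
      rw [h0, h1, this] at hs
      linarith
    refine ⟨(A + B) / 2, hA0, ?_⟩
    rw [leaderRisk, ← hL, hzero, distanceRisk_sub_zero_of_zero, decisionGap, ← hL, hzero]
    simp
    ring
  · have hle : 0 ≤ k₀ t r - k₁ t r := nonneg_of_mul_nonneg_right h hpos
    have hA0 : 0 < A := by
      have : 0 < A / e := by linarith
      exact (div_pos_iff_of_pos_right he0).1 this
    refine ⟨A, hA0, ?_⟩
    rw [leaderRisk, ← hL, distanceRisk_sub_zero_of_pos hpos hd, decisionGap, ← hL, sign_pos hpos,
      abs_of_pos hpos, h0, h1, hτe, SignType.coe_one, zpow_one]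
    field_simp
    ring

section Table

variable {M : ℝ}

theorem minimizers_leaderRisk_of_neg_of_neg (hτ : 0 < tau r) (hM : 0 ≤ M)
    (hc : Real.log (tau r) * (k₀ t r - k₁ t r) < 0) (hs : k₀ t r + k₁ t r < 0) :
    minimizers (leaderRisk t r) M = {min M
      (Real.sqrt |2 * Real.log (tau r) * (k₀ t r - k₁ t r) / (k₀ t r + k₁ t r)|)} := by
  have hq : 0 ≤ 2 * Real.log (tau r) * (k₀ t r - k₁ t r) / (k₀ t r + k₁ t r) :=
    div_nonneg_of_nonpos (by linarith) hs.le
  rw [abs_of_nonneg hq]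
  set q := 2 * Real.log (tau r) * (k₀ t r - k₁ t r) / (k₀ t r + k₁ t r) with hqdef
  have hmul : 2 * Real.log (tau r) * (k₀ t r - k₁ t r) = (k₀ t r + k₁ t r) * q := by
    rw [hqdef, mul_div_cancel₀ _ hs.ne]
  refine minimizers_of_anti_mono ⟨le_min hM (Real.sqrt_nonneg _), min_le_left _ _⟩
    (leaderRisk_strictAntiOn hτ le_rfl fun d hd ↦ ?_)
    (leaderRisk_strictMonoOn hτ (le_min hM (Real.sqrt_nonneg _)) fun d hd ↦ ?_)
  · rw [hmul]
    refine mul_lt_mul_of_neg_left ?_ hs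
    exact (Real.lt_sqrt hd.1.le).1 (hd.2.trans_le (min_le_right _ _))
  · rw [hmul]
    refine mul_lt_mul_of_neg_left ?_ hs
    have hlt := (min_lt_iff.1 hd.1).resolve_left hd.2.not_gt
    exact (Real.sqrt_lt' ((Real.sqrt_nonneg _).trans_lt hlt)).1 hlt

theorem minimizers_leaderRisk_of_neg_of_nonneg (hτ : 0 < tau r) (hM : 0 ≤ M)
    (hc : Real.log (tau r) * (k₀ t r - k₁ t r) < 0) (hs : 0 ≤ k₀ t r + k₁ t r) :
    minimizers (leaderRisk t r) M = {M} :=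
  minimizers_of_anti hM <| leaderRisk_strictAntiOn hτ le_rfl fun d _ ↦ by
    have := mul_nonneg hs (sq_nonneg d)
    linarith

theorem minimizers_leaderRisk_of_nonneg_of_neg (hτ : 0 < tau r) (hM : 0 ≤ M)
    (hc : 0 ≤ Real.log (tau r) * (k₀ t r - k₁ t r)) (hs : k₀ t r + k₁ t r < 0) :
    minimizers (leaderRisk t r) M = {0} :=
  minimizers_of_mono hM <| leaderRisk_strictMonoOn hτ le_rfl fun d hd ↦ by
    have := mul_neg_of_neg_of_pos hs (pow_pos hd.1 2)
    linarith

theorem minimizers_leaderRisk_of_sq_lt (hτ : 0 < tau r) (hM : 0 ≤ M)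
    (hc : 0 ≤ Real.log (tau r) * (k₀ t r - k₁ t r)) (hs : 0 < k₀ t r + k₁ t r)
    (hlt : M ^ 2 < |2 * Real.log (tau r) * (k₀ t r - k₁ t r) / (k₀ t r + k₁ t r)|) :
    minimizers (leaderRisk t r) M = {0} := by
  rw [abs_of_nonneg (div_nonneg (by linarith) hs.le), lt_div_iff₀ hs] at hlt
  refine minimizers_of_mono hM <| leaderRisk_strictMonoOn hτ le_rfl fun d hd ↦ lt_of_le_of_lt ?_ hlt
  rw [mul_comm]
  have := pow_le_pow_left₀ hd.1.le hd.2.le 2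
  gcongr

theorem minimizers_leaderRisk_of_le_sq (hτ : 0 < tau r) (hM : 0 < M)
    (hc : 0 ≤ Real.log (tau r) * (k₀ t r - k₁ t r)) (hs : 0 < k₀ t r + k₁ t r)
    (hle : |2 * Real.log (tau r) * (k₀ t r - k₁ t r) / (k₀ t r + k₁ t r)| ≤ M ^ 2) :
    (0 < decisionGap t r M → minimizers (leaderRisk t r) M = {M}) ∧
      (decisionGap t r M < 0 → minimizers (leaderRisk t r) M = {0}) ∧
      (decisionGap t r M = 0 → minimizers (leaderRisk t r) M = {0, M}) := by
  have hq : 0 ≤ 2 * Real.log (tau r) * (k₀ t r - k₁ t r) / (k₀ t r + k₁ t r) :=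
    div_nonneg (by linarith) hs.le
  rw [abs_of_nonneg hq] at hle
  set q := 2 * Real.log (tau r) * (k₀ t r - k₁ t r) / (k₀ t r + k₁ t r) with hqdef
  have hmul : 2 * Real.log (tau r) * (k₀ t r - k₁ t r) = (k₀ t r + k₁ t r) * q := by
    rw [hqdef, mul_div_cancel₀ _ hs.ne']
  obtain ⟨K, hK, hgap⟩ := leaderRisk_sub_zero hτ hc hs hM.ne'
  obtain ⟨h1, h2, h3⟩ := minimizers_of_mono_anti (g := leaderRisk t r)
    ⟨Real.sqrt_nonneg q, Real.sqrt_le_iff.2 ⟨hM.le, hle⟩⟩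
    (leaderRisk_strictMonoOn hτ le_rfl fun d hd ↦ by
      rw [hmul]
      exact mul_lt_mul_of_pos_left ((Real.lt_sqrt hd.1.le).1 hd.2) hs)
    (leaderRisk_strictAntiOn hτ (Real.sqrt_nonneg _) fun d hd ↦ by
      rw [hmul]
      exact mul_lt_mul_of_pos_left
        ((Real.sqrt_lt' ((Real.sqrt_nonneg _).trans_lt hd.1)).1 hd.1) hs)
  refine ⟨fun h ↦ h1 ?_, fun h ↦ h2 ?_, fun h ↦ h3 ?_⟩
  · have := mul_pos hK h
    linarith
  · have := mul_neg_of_pos_of_neg hK h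
    linarith
  · rw [h] at hgap
    linarith

theorem minimizers_leaderRisk_of_pos_of_eq_zero (hτ : 0 < tau r) (hM : 0 ≤ M)
    (hc : 0 < Real.log (tau r) * (k₀ t r - k₁ t r)) (hs : k₀ t r + k₁ t r = 0) :
    minimizers (leaderRisk t r) M = {0} :=
  minimizers_of_mono hM <| leaderRisk_strictMonoOn hτ le_rfl fun d _ ↦ by
    rw [hs]
    linarith

theorem minimizers_leaderRisk_of_eq_zero (hτ : 0 < tau r)
    (hc : Real.log (tau r) * (k₀ t r - k₁ t r) = 0) (hs : k₀ t r + k₁ t r = 0) :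
    minimizers (leaderRisk t r) M = Set.Icc 0 M :=
  minimizers_of_const fun x hx y hy ↦ distanceRisk_eq_of_zero
    (by rw [zeta_mul_tauNum_mul_exp t hτ, zeta_mul_tauDen_mul_exp t hτ]; linarith)
    (by rw [zeta_mul_tauNum_mul_exp t hτ, zeta_mul_tauDen_mul_exp t hτ, hs]) hx.1 hy.1

end Table

variable {ρ : Signals n → DecisionRule n}

/-- Against a reacting receiver, the risk of the transmitter depends on the signals only through
their distance. -/
theorem exists_bayesRisk_eq_leaderRisk (hSigma : Sigma.PosDef) (t : Player)
    (hD : tauDen r ≠ 0) (hτ : 0 < tau r) (hρ : IsReaction r Sigma P ρ)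
    (htie : tau r = 1 → k₀ t r ≠ k₁ t r → BreaksTiesEvenly r Sigma P ρ) :
    ∃ c : ℝ, ∀ S ∈ feasible n P,
      bayesRisk t Sigma S (ρ S) = c + leaderRisk t r (signalDist Sigma S) := by
  obtain ⟨j, hj⟩ := exists_isFavoured (Sigma := Sigma) hD
  obtain ⟨c, hc⟩ := hj t
  refine ⟨c, fun S hS ↦ ?_⟩
  rw [hc, leaderRisk, distanceRisk]
  by_cases h : signalDist Sigma S ≠ 0 ∨ Real.log (tau r) ≠ 0
  · rw [condProb_of_isBestResponse hSigma hD hτ hj h (hρ S hS),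
      condProb_of_isBestResponse hSigma hD hτ hj h (hρ S hS)]
    ring
  · push Not at h
    have hτ1 := Real.eq_one_of_pos_of_log_eq_zero hτ h.2
    have hS01 := (signalDist_eq_zero_iff hSigma S).1 h.1
    by_cases hk : k₀ t r = k₁ t r
    -- the transmitter does not care how ties are broken
    · have hAB : zeta r * tauNum t = zeta r * tauDen t := by
        rw [← zeta_mul_tauNum_mul_exp t hτ, ← zeta_mul_tauDen_mul_exp t hτ, h.2] at hk
        simpa using hk
      rw [mul_sub, ← mul_assoc, ← mul_assoc, hAB, condProb_of_eq hS01, sub_self, h.1,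
        exceedProb_at_zero 0 1, sub_self]
    · have hhalf := htie hτ1 hk S hS ((indifferent_iff hSigma hD hτ).2 ⟨hS01, hτ1⟩)
      rw [hhalf, hhalf, h.1, h.2]
      simp [exceedProb]
      ring

/-- Signals at a positive distance make the two hypotheses distinguishable. -/
theorem exceedProb_zero_lt_one (L : ℝ) {d : ℝ} (hd : 0 < d) :
    exceedProb 0 L d < exceedProb 1 L d := by
  simp only [exceedProb, hd.ne', if_false]
  refine strictAnti_Q ?_
  simp
  linarith

theorem not_nonInformative (hSigma : Sigma.PosDef) (hD : tauDen r ≠ 0) (hτ : 0 < tau r)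
    {S : Signals n} {δ : DecisionRule n} (hδ : IsBestResponse r Sigma S δ)
    (hd : signalDist Sigma S ≠ 0) : ¬ NonInformative Sigma S δ := by
  obtain ⟨j, hj⟩ := exists_isFavoured (Sigma := Sigma) hD
  intro h
  have h' := h j
  rw [condProb_of_isBestResponse hSigma hD hτ hj (Or.inl hd) hδ,
    condProb_of_isBestResponse hSigma hD hτ hj (Or.inl hd) hδ] at h'
  exact (exceedProb_zero_lt_one _ ((signalDist_nonneg S).lt_of_ne' hd)).ne h'

/-- At distance zero the likelihood ratio is constantly one, on one side of the threshold. -/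
theorem exists_condProb_eq_one (hSigma : Sigma.PosDef) (hD : tauDen r ≠ 0) (hτ : 0 < tau r)
    {S : Signals n} {δ : DecisionRule n} (hδ : IsBestResponse r Sigma S δ)
    (hd : signalDist Sigma S = 0) (hτ1 : tau r ≠ 1) :
    ∃ j : Fin 2, ∀ i, condProb Sigma S δ j i = 1 := by
  obtain ⟨j, hj⟩ := exists_isFavoured (Sigma := Sigma) hD
  have hL : Real.log (tau r) ≠ 0 := fun h ↦ hτ1 (Real.eq_one_of_pos_of_log_eq_zero hτ h)
  have hp := condProb_of_isBestResponse hSigma hD hτ hj (Or.inr hL) hδ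
  rw [hd] at hp
  rcases lt_or_gt_of_ne hL with h | h
  · refine ⟨j, fun i ↦ ?_⟩
    rw [hp]
    simp [exceedProb, h, h.not_gt]
  · refine ⟨1 - j, fun i ↦ ?_⟩
    rw [condProb_other, hp]
    simp [exceedProb, h]

theorem dMax_pos (hl : 0 < lam) (hPpos : 0 < P 0 + P 1) : 0 < dMax P lam := by
  rw [dMax_eq]
  refine div_pos ?_ (Real.sqrt_pos.2 hl)
  have h0 := Real.sqrt_nonneg (P 0)
  have h1 := Real.sqrt_nonneg (P 1)
  rcases lt_or_ge 0 (P 0) with h | h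
  · have := Real.sqrt_pos.2 h
    linarith
  · have := Real.sqrt_pos.2 (show 0 < P 1 by linarith)
    linarith

variable (hSigma : Sigma.PosDef)
  (hlam : IsLeast {μ : ℝ | Module.End.HasEigenvalue (Matrix.toLin' Sigma) μ} lam)
  (hP : ∀ i, 0 ≤ P i)
include hSigma hlam hP

theorem exists_signals {x : ℝ} (hx : x ∈ Set.Icc 0 (dMax P lam)) :
    ∃ S ∈ feasible n P, signalDist Sigma S = x := by
  have hl := minEigenvalue_pos hSigma hlam.1
  obtain ⟨v, hv⟩ := hlam.1.exists_hasEigenvector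
  obtain ⟨s₀, s₁, h0, h1, h⟩ := exists_scalars hl hx
  have hν : WithLp.toLp 2 v ≠ 0 := fun h ↦ hv.2 (by simpa using h)
  refine ⟨signalsAlong (WithLp.toLp 2 v) s₀ s₁, signalsAlong_mem_feasible hP hν h0 h1, ?_⟩
  rw [signalDist_signalsAlong hSigma hv, h, mul_div_cancel_left₀ _ (Real.sqrt_pos.2 hl).ne']

/-- The equilibria are the signals whose distance minimizes the risk over the attainable
distances. -/
theorem isStackelberg_iff (hD : tauDen r ≠ 0) (hτ : 0 < tau r) (hρ : IsReaction r Sigma P ρ)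
    (htie : tau r = 1 → k₀ t r ≠ k₁ t r → BreaksTiesEvenly r Sigma P ρ) (S : Signals n) :
    IsStackelberg t r Sigma P ρ S ↔ S ∈ feasible n P ∧
      signalDist Sigma S ∈ minimizers (leaderRisk t r) (dMax P lam) := by
  obtain ⟨c, hc⟩ := exists_bayesRisk_eq_leaderRisk hSigma t hD hτ hρ htie
  rw [IsStackelberg]
  refine and_congr_right fun hS ↦ ⟨fun h ↦ ⟨⟨signalDist_nonneg S,
    signalDist_le_dMax hSigma hlam hS⟩, fun y hy ↦ ?_⟩, fun h ↦ ⟨hρ, fun S' hS' ↦ ?_⟩⟩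
  · obtain ⟨S', hS', rfl⟩ := exists_signals hSigma hlam hP hy
    have := h.2 S' hS'
    rwa [hc S hS, hc S' hS', add_le_add_iff_left] at this
  · rw [hc S hS, hc S' hS', add_le_add_iff_left]
    exact h.2 _ ⟨signalDist_nonneg S', signalDist_le_dMax hSigma hlam hS'⟩

theorem equilibriumDistances_eq (hD : tauDen r ≠ 0) (hτ : 0 < tau r)
    (hρ : IsReaction r Sigma P ρ)
    (htie : tau r = 1 → k₀ t r ≠ k₁ t r → BreaksTiesEvenly r Sigma P ρ) :
    equilibriumDistances t r Sigma P ρ = minimizers (leaderRisk t r) (dMax P lam) := by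
  ext x
  constructor
  · rintro ⟨S, hS, rfl⟩
    exact ((isStackelberg_iff hSigma hlam hP hD hτ hρ htie S).1 hS).2
  · intro hx
    obtain ⟨S, hS, rfl⟩ := exists_signals hSigma hlam hP hx.1
    exact ⟨S, (isStackelberg_iff hSigma hlam hP hD hτ hρ htie S).2 ⟨hS, hx⟩, rfl⟩

end Leader

end BinarySignaling

end

open BinarySignaling in
theorem theorem5 (n : ℕ) (Sigma : Matrix (Fin n) (Fin n) ℝ) (hSigma : Sigma.PosDef)
    (lam : ℝ) (hlam : IsLeast {μ : ℝ | Module.End.HasEigenvalue (Matrix.toLin' Sigma) μ} lam)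
    (P : Fin 2 → ℝ) (hP : ∀ i, 0 ≤ P i) (hPpos : 0 < P 0 + P 1)
    (t r : Player) (hac : ∀ i, t.prior i = 0 ↔ r.prior i = 0) :
    -- `τ ≤ 0` or `τ = ∞`
    ((tauDen r ≠ 0 ∧ tau r ≤ 0) ∨ (tauDen r = 0 ∧ tauNum r ≠ 0) →
      (∃ ρ : Signals n → DecisionRule n, IsReaction r Sigma P ρ) ∧
      (∃ j : Fin 2, ∀ ρ : Signals n → DecisionRule n, IsReaction r Sigma P ρ →
        ∀ S ∈ feasible n P,
          IsStackelberg t r Sigma P ρ S ∧ NonInformative Sigma S (ρ S) ∧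
            ∀ i, condProb Sigma S (ρ S) j i = 1)) ∧
    -- `0 < τ < ∞`
    (tauDen r ≠ 0 → 0 < tau r →
      (∃ ρ : Signals n → DecisionRule n,
        IsReaction r Sigma P ρ ∧ BreaksTiesEvenly r Sigma P ρ) ∧
      (∀ ρ : Signals n → DecisionRule n, IsReaction r Sigma P ρ →
        (tau r = 1 → k₀ t r ≠ k₁ t r → BreaksTiesEvenly r Sigma P ρ) →
        -- the table
        (Real.log (tau r) * (k₀ t r - k₁ t r) < 0 → k₀ t r + k₁ t r < 0 →
          equilibriumDistances t r Sigma P ρ =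
            {min (dMax P lam)
              (Real.sqrt |2 * Real.log (tau r) * (k₀ t r - k₁ t r) / (k₀ t r + k₁ t r)|)}) ∧
        (Real.log (tau r) * (k₀ t r - k₁ t r) < 0 → 0 ≤ k₀ t r + k₁ t r →
          equilibriumDistances t r Sigma P ρ = {dMax P lam}) ∧
        (0 ≤ Real.log (tau r) * (k₀ t r - k₁ t r) → k₀ t r + k₁ t r < 0 →
          equilibriumDistances t r Sigma P ρ = {0}) ∧
        (0 ≤ Real.log (tau r) * (k₀ t r - k₁ t r) → 0 < k₀ t r + k₁ t r →
          (dMax P lam ^ 2 <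
              |2 * Real.log (tau r) * (k₀ t r - k₁ t r) / (k₀ t r + k₁ t r)| →
            equilibriumDistances t r Sigma P ρ = {0}) ∧
          (|2 * Real.log (tau r) * (k₀ t r - k₁ t r) / (k₀ t r + k₁ t r)| ≤
              dMax P lam ^ 2 →
            (0 < decisionGap t r (dMax P lam) →
              equilibriumDistances t r Sigma P ρ = {dMax P lam}) ∧
            (decisionGap t r (dMax P lam) < 0 →
              equilibriumDistances t r Sigma P ρ = {0}) ∧
            (decisionGap t r (dMax P lam) = 0 →
              equilibriumDistances t r Sigma P ρ = {0, dMax P lam}))) ∧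
        -- the same cell of the table when the quotient has denominator zero
        (0 < Real.log (tau r) * (k₀ t r - k₁ t r) → k₀ t r + k₁ t r = 0 →
          equilibriumDistances t r Sigma P ρ = {0}) ∧
        (Real.log (tau r) * (k₀ t r - k₁ t r) = 0 → k₀ t r + k₁ t r = 0 →
          equilibriumDistances t r Sigma P ρ = Set.Icc 0 (dMax P lam)) ∧
        -- the equilibria are the feasible signal pairs at an equilibrium distance
        (∀ S ∈ feasible n P, IsStackelberg t r Sigma P ρ S ↔
          signalDist Sigma S ∈ equilibriumDistances t r Sigma P ρ) ∧
        -- distance zero is non-informative, a nonzero distance is informative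
        (∀ S, IsStackelberg t r Sigma P ρ S →
          (signalDist Sigma S = 0 →
            S 0 = S 1 ∧ NonInformative Sigma S (ρ S) ∧
              (tau r ≠ 1 → ∃ j : Fin 2, ∀ i, condProb Sigma S (ρ S) j i = 1)) ∧
          (signalDist Sigma S ≠ 0 → ¬ NonInformative Sigma S (ρ S))) ∧
        -- signalling along any eigenvector of the minimal eigenvalue
        (∀ ν : EuclideanSpace ℝ (Fin n),
          Module.End.HasEigenvector (Matrix.toLin' Sigma) lam ν.ofLp →
          (dMax P lam ∈ equilibriumDistances t r Sigma P ρ →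
            IsStackelberg t r Sigma P ρ
              (signalsAlong ν (Real.sqrt (P 0)) (-Real.sqrt (P 1))) ∧
            IsStackelberg t r Sigma P ρ
              (signalsAlong ν (-Real.sqrt (P 0)) (Real.sqrt (P 1)))) ∧
          (∀ x ∈ equilibriumDistances t r Sigma P ρ,
            (∃ s₀ s₁ : ℝ, |s₀| ≤ Real.sqrt (P 0) ∧ |s₁| ≤ Real.sqrt (P 1) ∧
              |s₁ - s₀| = Real.sqrt lam * x) ∧
            (∀ s₀ s₁ : ℝ, |s₀| ≤ Real.sqrt (P 0) → |s₁| ≤ Real.sqrt (P 1) →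
              |s₁ - s₀| = Real.sqrt lam * x →
                IsStackelberg t r Sigma P ρ (signalsAlong ν s₀ s₁) ∧
                signalDist Sigma (signalsAlong ν s₀ s₁) = x)))))
  := by
  have hl := minEigenvalue_pos hSigma hlam.1
  have hM := dMax_pos hl hPpos
  have : NeZero n := ⟨by
    rintro rfl
    obtain ⟨v, hv⟩ := hlam.1.exists_hasEigenvector
    exact hv.2 (Subsingleton.elim _ _)⟩
  refine ⟨fun h ↦ ?_, fun hD hτ ↦ ⟨exists_reaction_breaksTiesEvenly hSigma P hD hτ,
    fun ρ hρ htie ↦ ?_⟩⟩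
  · obtain ⟨j, a, b, c, ha, hb, hab, hrisk⟩ :=
      exists_dominant_decision (n := n) (Sigma := Sigma) h
    refine ⟨⟨fun _ ↦ ruleOn j .univ, fun S _ η ↦ ?_⟩, j, fun ρ hρ ↦ ?_⟩
    · rw [hrisk, hrisk, condProb_ruleOn, condProb_ruleOn, probReal_univ, probReal_univ]
      gcongr <;> exact condProb_le_one _ _ _ _
    · have hone : ∀ S ∈ feasible n P, ∀ i, condProb Sigma S (ρ S) j i = 1 := fun S hS i ↦
        condProb_eq_one_of_dominant hSigma ha hb hab hrisk (hρ S hS) i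
      have hall : ∀ S ∈ feasible n P, ∀ j' i,
          condProb Sigma S (ρ S) j' i = if j' = j then 1 else 0 := by
        intro S hS j' i
        split_ifs with hj'
        · rw [hj', hone S hS]
        · have h1 := hone S hS i
          have : j' = 1 - j := by omega
          rw [this, condProb_other, h1, sub_self]
      refine fun S hS ↦ ⟨⟨hS, hρ, fun S' hS' ↦ ?_⟩, fun j' ↦ ?_, hone S hS⟩
      · simp only [BinarySignaling.bayesRisk, hall S hS, hall S' hS', le_refl]
      · rw [hall S hS, hall S hS]
  · rw [equilibriumDistances_eq hSigma hlam hP hD hτ hρ htie]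
    have hiff := isStackelberg_iff hSigma hlam hP hD hτ hρ htie
    refine ⟨minimizers_leaderRisk_of_neg_of_neg hτ hM.le,
      minimizers_leaderRisk_of_neg_of_nonneg hτ hM.le,
      minimizers_leaderRisk_of_nonneg_of_neg hτ hM.le,
      fun hc hs ↦ ⟨minimizers_leaderRisk_of_sq_lt hτ hM.le hc hs,
        minimizers_leaderRisk_of_le_sq hτ hM hc hs⟩,
      minimizers_leaderRisk_of_pos_of_eq_zero hτ hM.le,
      minimizers_leaderRisk_of_eq_zero hτ,
      fun S hS ↦ (hiff S).trans (and_iff_right hS),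
      fun S hS ↦ ⟨fun hd ↦ ?_, not_nonInformative hSigma hD hτ (hρ S hS.1)⟩,
      fun ν hν ↦ ?_⟩
    · have hS01 := (signalDist_eq_zero_iff hSigma S).1 hd
      exact ⟨hS01, condProb_of_eq hS01 _,
        exists_condProb_eq_one hSigma hD hτ (hρ S hS.1) hd⟩
    · have hν0 : ν ≠ 0 := fun h ↦ hν.2 (by simp [h])
      have hsl := Real.sqrt_pos.2 hl
      have key : ∀ x ∈ minimizers (leaderRisk t r) (dMax P lam), ∀ s₀ s₁ : ℝ,
          |s₀| ≤ Real.sqrt (P 0) → |s₁| ≤ Real.sqrt (P 1) → |s₁ - s₀| = Real.sqrt lam * x →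
            IsStackelberg t r Sigma P ρ (signalsAlong ν s₀ s₁) ∧
              signalDist Sigma (signalsAlong ν s₀ s₁) = x := by
        intro x hx s₀ s₁ h0 h1 h
        have hdist : signalDist Sigma (signalsAlong ν s₀ s₁) = x := by
          rw [signalDist_signalsAlong hSigma hν, h, mul_div_cancel_left₀ _ hsl.ne']
        exact ⟨(hiff _).2 ⟨signalsAlong_mem_feasible hP hν0 h0 h1, hdist.symm ▸ hx⟩, hdist⟩
      have hp0 := Real.sqrt_nonneg (P 0)
      have hp1 := Real.sqrt_nonneg (P 1)
      have hdm : Real.sqrt lam * dMax P lam = Real.sqrt (P 0) + Real.sqrt (P 1) := by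
        rw [dMax_eq, mul_div_cancel₀ _ hsl.ne']
      refine ⟨fun hx ↦ ⟨(key _ hx _ _ ?_ ?_ ?_).1, (key _ hx _ _ ?_ ?_ ?_).1⟩,
        fun x hx ↦ ⟨exists_scalars hl hx.1, key x hx⟩⟩
      · rw [abs_of_nonneg hp0]
      · rw [abs_neg, abs_of_nonneg hp1]
      · rw [hdm, abs_of_nonpos (by linarith)]
        ring
      · rw [abs_neg, abs_of_nonneg hp0]
      · rw [abs_of_nonneg hp1]
      · rw [hdm, abs_of_nonneg (by linarith)]
        ring
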